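/- Let $\Delta^0$ be a finite irreducible reduced crystallographic root system with simple roots $\alpha_j$, $j\in I_0$, let $\beta_{\mathrm{long}}=\sum_{j\in I_0} m_j\alpha_j$ be its longest (highest) root, and let $l(\beta_{\mathrm{long}})=\sum_j m_j$. Let $\Gamma$ be the extended Dynkin graph of $\Delta^0$. Its vertex set is $I=I_0\sqcup\{*\}$ and its Cartan matrix is $c_{ij}=\langle\alpha_j,\alpha_i^\vee\rangle$, where $\alpha_*:=-\beta_{\mathrm{long}}$. Let $\operatorname{Aut}(\Gamma)$ be the group of permutations of $I$ preserving $C=(c_{ij})$, and call the vertices in the $\operatorname{Aut}(\Gamma)$-orbit of $*$ extending. Let $\delta\in\mathbb Z^I$ be given by $\delta_*=1$ and $\delta_j=m_j$ for $j\in I_0$. For an extending vertex $i$, let $\omega^{(i)}\in\mathbb R^I$ be the $i$-th standard basis vector and let $\rho^{(i)}\in\mathbb R^I$ be the vector with $\rho^{(i)}_j=1$ for $j\ne i$ and $\sum_j\delta_j\rho^{(i)}_j=0$. Firing a vertex $i$ replaces $v\in\mathbb R^I$ by the vector $f_i(v)$ with $f_i(v)_j=v_j-c_{ij}v_i$ (so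 $f_i(v)_i=-v_i$). A sequence of vertices is a valid firing sequence for the numbers game from $v$ if, when its vertices are fired in order starting from $v$, each has amplitude $v_i<0$ at the moment it is fired; it is a firing sequence of amplitudes $<-1$ if each amplitude fired is $<-1$. There is an automorphism $\iota\in\operatorname{Aut}(\Gamma)$ with $\iota^2=1$ such that, for every extending vertex $i_0$ and every $\kappa\in\bigl(1,\,1+\frac1{l(\beta_{\mathrm{long}})-1}\bigr)$ (where $\frac10=\infty$), the following holds with $u_\kappa:=\rho^{(i_0)}+\kappa\omega^{(i_0)}$. 1. A sequence of vertices is a valid firing sequence for the numbers game from $u_\kappa$ if and only if it is a firing sequence of amplitudes $<-1$ from $\rho^{(i_0)}$. 2. There is no infinite such sequence. Every maximal such sequence takes $u_\kappa$ to $(\kappa-1)\rho^{(\iota(i_0))}+\kappa\omega^{(\iota(i_0))}$ and takes $\rho^{(i_0)}$ to $-\rho^{(\iota(i_0))}$. -/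

import Mathlib

/-! ### The numbers game with matrix `C` on the vertex set `I` -/

/-- Firing the vertex `i`: `v_i` becomes `-v_i` (as `c_ii = 2`) and `v_j` becomes `v_j - c_ij v_i`
for `j ≠ i` (so nothing changes at the vertices not adjacent to `i`, where `c_ij = 0`). -/
def fire {I : Type*} (C : Matrix I I ℤ) (i : I) (v : I → ℝ) : I → ℝ :=
  fun j => v j - (C i j : ℝ) * v i

/-- The configuration reached from `v` by firing the vertices of a finite list in order. -/
def play {I : Type*} (C : Matrix I I ℤ) : (I → ℝ) → List I → (I → ℝ)
  | v, [] => v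
  | v, i :: L => play C (fire C i v) L

/-- Starting at `v`, the vertices of the list can be fired in order so that every vertex has
amplitude `< t` at the moment when it is fired. The numbers game is the case `t = 0`; firing only
amplitudes `< -1` is the case `t = -1`. -/
def IsFiringSeq {I : Type*} (C : Matrix I I ℤ) (t : ℝ) : (I → ℝ) → List I → Prop
  | _, [] => True
  | v, i :: L => v i < t ∧ IsFiringSeq C t (fire C i v) L

/-- A firing sequence that cannot be prolonged. -/
def IsMaximalFiringSeq {I : Type*} (C : Matrix I I ℤ) (t : ℝ) (v : I → ℝ) (L : List I) : Prop :=
  IsFiringSeq C t v L ∧ ∀ i, ¬ IsFiringSeq C t v (L ++ [i])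

/-! ### The vectors `ω` and `ρ` -/

open Classical in
/-- `ω^(i)`, the `i`-th basis vector of configuration space. -/
noncomputable def omegaVec {I : Type*} (i : I) : I → ℝ :=
  fun j => if j = i then 1 else 0

open Classical in
/-- `ρ^(i)`: the configuration `v` with `v_j = 1` for all `j ≠ i` and `∑ j, δ_j v_j = 0`. -/
noncomputable def rhoVec {I : Type*} [Fintype I] (δ : I → ℝ) (i : I) : I → ℝ :=
  fun j => if j = i then -(∑ k ∈ Finset.univ.filter (fun k => k ≠ i), δ k) / δ i else 1

/-- The defining property of `ρ^(i)`. -/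
theorem sum_mul_rhoVec {I : Type*} [Fintype I] (δ : I → ℝ) (i : I) (hi : δ i ≠ 0) :
    ∑ j, δ j * rhoVec δ i j = 0 := by
  classical
  rw [← Finset.add_sum_erase _ _ (Finset.mem_univ i)]
  have h : ∑ x ∈ Finset.univ.erase i, δ x * rhoVec δ i x = ∑ x ∈ Finset.univ.erase i, δ x :=
    Finset.sum_congr rfl fun x hx => by simp [rhoVec, Finset.ne_of_mem_erase hx]
  rw [h]
  have h2 : (Finset.univ.filter fun k => k ≠ i) = Finset.univ.erase i := by
    ext; simp
  simp only [rhoVec, if_true]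
  rw [mul_div_cancel₀ _ hi, Finset.filter_congr_decidable, h2]
  ring

/-! ### The extended Dynkin graph of a finite root system

`P` is a finite crystallographic root system with base `b`; the vertices of its extended Dynkin
graph are the simple roots (`some j`) and one more vertex `none`, attached by means of the longest
root, with index `θ`. -/

section Extended

variable {ι M N : Type*} [AddCommGroup M] [Module ℝ M] [AddCommGroup N] [Module ℝ N]
  {P : RootPairing ι ℝ M N}

/-- The element of the finite root system that a vertex stands for: the simple root `α_j` for
`some j`, and minus the longest root for `none` (the affine simple root `δ - β_long` modulo `δ`). -/
def extRoot (b : P.Base) (θ : ι) : Option b.support → ι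
  | none => P.reflectionPerm θ θ
  | some j => j

/-- The Cartan matrix of the extended Dynkin graph: `c_ij = ⟨α_j, α_i^∨⟩`. -/
noncomputable def extCartan [P.IsCrystallographic] (b : P.Base) (θ : ι) :
    Matrix (Option b.support) (Option b.support) ℤ :=
  fun i j => P.pairingIn ℤ (extRoot b θ j) (extRoot b θ i)

/-- `δ = α_none + β_long` in the basis of simple roots: `1` at `none`, and at `some j` the
coefficient of the simple root `α_j` in the longest root. -/
noncomputable def extDelta [P.IsRootSystem] (b : P.Base) (θ : ι) : Option b.support → ℝ
  | none => 1
  | some j => b.toWeightBasis.repr (P.root θ) j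

end Extended

/-- The automorphisms of the graph with matrix `C`: permutations of the vertices which preserve
all the entries of `C`. -/
def IsGraphAut {I : Type*} (C : Matrix I I ℤ) (σ : Equiv.Perm I) : Prop :=
  ∀ i j, C (σ i) (σ j) = C i j

/-- Extending vertices: the images of the vertex `none` under automorphisms of the graph, i.e. the
vertices `i` such that the graph is, with `i` as the added vertex, the extended Dynkin graph of
the complement of `i`. -/
def IsExtendingVertex {I : Type*} (C : Matrix (Option I) (Option I) ℤ) (i : Option I) : Prop :=
  ∃ σ : Equiv.Perm (Option I), IsGraphAut C σ ∧ σ none = i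

/-! Write a real affine root a + kδ as a pair (a, k). A configuration is a linear functional on
affine roots and firing i is dual to the simple reflection s_i, so after playing L the amplitude at
i is the initial value at wα_i, where w is the product of the reflections in L (`play_apply`). At
(a, k) the functional ρ takes the value ht(a) and ω the value k, so u_κ takes the value ht(a) + κk.
Graph automorphisms reduce everything to i₀ = `none`. Let l be the height of θ.

At positive level only finitely many positive affine roots have negative value, and each valid
firing shrinks their number, so the game stops (`ncard_negSet_fire_lt`). All inversions of w are
such roots (`IsFiringSeq.affEval_neg_of_inversion`).

The two kinds of firing agree (`play_neg_iff_play_rhoVec_lt`): if β = wα_i = (a, k) had ht(a) < -1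
but ht(a) + κk ≥ 0, then β would be positive, the bound on κ would force k ≥ -ht(a), and β would
split into two positive roots at which u_κ is nonnegative. These are not inversions, so w⁻¹ keeps
them positive and α_i would be a sum of two positive roots.

When play stops, write the amplitudes as h + κk with h coming from ρ and k from ω. The bound on κ
makes the integers h + k nonnegative, and their δ-weighted sum is 1; hence h + k = ω^(p) with δ_p =
1, and then h = -ρ^(p) (`play_eq_of_nonneg_of_small`).

To identify p, work modulo the lattice spanned by the rows of the matrix. Firing preserves classes
of integral configurations, and the ω^(p) with δ_p = 1 lie in distinct classes because they are
minuscule or zero on the finite roots (`eq_of_omegaVec_sub_mem`). The end position gives ω^(p) ≡ ω +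
ρ. Translation by ρ permutes the affine simple roots up to the affine Weyl group, which defines a
graph automorphism (`exists_translation_aut`); since 2ρ ≡ 0 it is an involution
(`exists_involutive_aut`). This is ι. -/

set_option linter.unusedSectionVars false

/-! ### Finite root systems: heights, simple-root coefficients and the highest root. -/

section FiniteFacts

variable {ι M N : Type*} [AddCommGroup M] [Module ℝ M] [AddCommGroup N] [Module ℝ N]
  {P : RootPairing ι ℝ M N}

/-- The coefficient of the simple root `j` in the root `a`. -/
noncomputable def rootCoef [P.IsRootSystem] (b : P.Base) (a : ι) (j : b.support) : ℝ :=
  b.toWeightBasis.repr (P.root a) j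

theorem sum_rootCoef_smul [P.IsRootSystem] (b : P.Base) (a : ι) :
    ∑ j, rootCoef b a j • P.root j = P.root a := by
  simpa [rootCoef] using b.toWeightBasis.sum_repr (P.root a)

theorem rootCoef_eq_intCast [P.IsRootSystem] (b : P.Base) (a : ι) :
    ∃ f : b.support → ℤ, (∀ j, rootCoef b a j = f j) ∧ b.height a = ∑ j, f j ∧
      (0 < b.height a → ∀ j, 0 ≤ f j) := by
  obtain ⟨f, hf₀, hf₁, hf₂⟩ := b.exists_root_eq_sum_int a
  have hs : P.root a = ∑ j : b.support, (f j : ℝ) • b.toWeightBasis j := by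
    rw [hf₂, b.support.sum_subtype (p := (· ∈ b.support)) (by simp) (F := inferInstance)]
    simp [Int.cast_smul_eq_zsmul]
  have hh := RootPairing.Base.height_eq_sum hf₂
  refine ⟨fun j => f j, fun j => ?_, ?_, fun hpos j => ?_⟩
  · rw [rootCoef, hs, Module.Basis.repr_sum_self]
  · rw [hh, b.support.sum_subtype (p := (· ∈ b.support)) (by simp) (F := inferInstance)]
  · rcases hf₁ with h | h
    · exact h.le j
    · have : b.height a ≤ 0 := by
        rw [hh]; exact Finset.sum_nonpos fun i _ => h.le i
      omega

theorem height_eq_sum_rootCoef [P.IsRootSystem] (b : P.Base) (a : ι) :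
    (b.height a : ℝ) = ∑ j, rootCoef b a j := by
  obtain ⟨f, h1, h2, -⟩ := rootCoef_eq_intCast b a
  simp [h1, h2]

theorem rootCoef_nonneg [P.IsRootSystem] (b : P.Base) {a : ι} (ha : 0 < b.height a)
    (j : b.support) : 0 ≤ rootCoef b a j := by
  obtain ⟨f, h1, -, h3⟩ := rootCoef_eq_intCast b a
  rw [h1]; exact_mod_cast h3 ha j

theorem rootCoef_injective [P.IsRootSystem] (b : P.Base) {a c : ι}
    (h : ∀ j, rootCoef b a j = rootCoef b c j) : a = c := by
  apply P.root.injective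
  rw [← sum_rootCoef_smul b a, ← sum_rootCoef_smul b c]
  simp [h]

theorem height_neg (b : P.Base) (a : ι) :
    b.height (P.reflectionPerm a a) = -b.height a :=
  b.height_reflectionPerm_self a

theorem root_neg (a : ι) : P.root (P.reflectionPerm a a) = -P.root a := by simp

theorem rootCoef_of_root_eq_add [P.IsRootSystem] (b : P.Base) {a c d : ι}
    (h : P.root d = P.root a + P.root c) (j : b.support) :
    rootCoef b d j = rootCoef b a j + rootCoef b c j := by
  simp [rootCoef, h]

theorem rootCoef_neg [P.IsRootSystem] (b : P.Base) (a : ι) (j : b.support) :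
    rootCoef b (P.reflectionPerm a a) j = -rootCoef b a j := by
  rw [rootCoef, root_neg]; simp [rootCoef]

open Classical in
theorem rootCoef_simple [P.IsRootSystem] (b : P.Base) (i j : b.support) :
    rootCoef b i j = if i = j then 1 else 0 := by
  rw [rootCoef, b.toWeightBasis_repr_root, Finsupp.single_apply]

variable [P.IsCrystallographic]

theorem pairingIn_cast (a c : ι) : ((P.pairingIn ℤ a c : ℤ) : ℝ) = P.pairing a c := by
  simpa using P.algebraMap_pairingIn ℤ a c

theorem root_reflectionPerm_eq (a c : ι) :
    P.root (P.reflectionPerm c a) = P.root a - (P.pairingIn ℤ a c : ℝ) • P.root c := by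
  rw [P.root_reflectionPerm, P.reflection_apply_root, pairingIn_cast]

theorem rootCoef_reflectionPerm [P.IsRootSystem] (b : P.Base) (a c : ι) (j : b.support) :
    rootCoef b (P.reflectionPerm c a) j = rootCoef b a j - P.pairingIn ℤ a c * rootCoef b c j := by
  rw [rootCoef, root_reflectionPerm_eq]; simp [rootCoef]

theorem height_reflectionPerm [P.IsRootSystem] (b : P.Base) (a c : ι) :
    b.height (P.reflectionPerm c a) = b.height a - P.pairingIn ℤ a c * b.height c := by
  have : (b.height (P.reflectionPerm c a) : ℝ) =
      b.height a - P.pairingIn ℤ a c * b.height c := by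
    simp only [height_eq_sum_rootCoef, rootCoef_reflectionPerm, Finset.sum_sub_distrib,
      Finset.mul_sum]
  exact_mod_cast this

theorem pairing_eq_sum [P.IsRootSystem] (b : P.Base) (a c : ι) :
    (P.pairingIn ℤ a c : ℝ) = ∑ j : b.support, rootCoef b a j * P.pairingIn ℤ j c := by
  simp_rw [pairingIn_cast]
  rw [← P.root_coroot'_eq_pairing, ← sum_rootCoef_smul b a]
  simp

variable [Finite ι]

theorem neg_height_le (b : P.Base) {θ : ι} (hθ : ∀ k, b.height k ≤ b.height θ) (a : ι) :
    -b.height θ ≤ b.height a := by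
  have := hθ (P.reflectionPerm a a)
  rw [height_neg] at this
  omega

theorem height_max_pos [P.IsRootSystem] (b : P.Base) {θ : ι}
    (hθ : ∀ k, b.height k ≤ b.height θ) : 0 < b.height θ := by
  have h1 := neg_height_le b hθ θ
  have := b.height_ne_zero θ
  omega

/-- Otherwise the simple reflection at j would raise the height of θ. -/
theorem pairing_highest_nonneg [P.IsRootSystem] (b : P.Base) {θ : ι}
    (hθ : ∀ k, b.height k ≤ b.height θ) {j : ι} (hj : j ∈ b.support) :
    0 ≤ P.pairingIn ℤ θ j := by
  by_contra! h
  have h1 := hθ (P.reflectionPerm j θ)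
  rw [height_reflectionPerm, RootPairing.Base.height_one_of_mem_support hj] at h1
  omega

/-- The support of θ is closed under adjacency: at a neighbour k with coefficient 0, the terms of
⟨θ, α_k^∨⟩ would all be nonpositive and one negative, against dominance. Irreducibility then makes
the support everything. -/
theorem rootCoef_highest_pos [P.IsRootSystem] [P.IsReduced] [P.IsIrreducible] (b : P.Base) {θ : ι}
    (hθ : ∀ k, b.height k ≤ b.height θ) (j : b.support) : 0 < rootCoef b θ j := by
  classical
  have hpos := height_max_pos b hθ
  obtain ⟨i, hi⟩ : ∃ i, 0 < rootCoef b θ i := by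
    by_contra! h
    have : (b.height θ : ℝ) ≤ 0 := by
      rw [height_eq_sum_rootCoef]; exact Finset.sum_nonpos fun i _ => h i
    have : b.height θ ≤ 0 := by exact_mod_cast this
    omega
  refine b.induction_on_cartanMatrix (fun j => 0 < rootCoef b θ j) hi fun i k hi hik => ?_
  refine lt_of_le_of_ne (rootCoef_nonneg b hpos k) fun h0 => ?_
  have hki : i ≠ k := by rintro rfl; exact hi.ne h0
  have h1 := pairing_highest_nonneg b hθ k.2
  have h2 := pairing_eq_sum b θ k
  have h3 : ∀ j : b.support, rootCoef b θ j * (P.pairingIn ℤ j k : ℝ) ≤ 0 := by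
    intro j
    by_cases hjk : j = k
    · rw [hjk, ← h0, zero_mul]
    · refine mul_nonpos_of_nonneg_of_nonpos (rootCoef_nonneg b hpos j) ?_
      exact_mod_cast b.pairingIn_le_zero_of_ne (fun h => hjk (Subtype.ext h)) j.2 k.2
  have h4 : ∑ j : b.support, rootCoef b θ j * (P.pairingIn ℤ j k : ℝ) < 0 := by
    refine Finset.sum_neg' (fun j _ => h3 j) ⟨i, Finset.mem_univ _, ?_⟩
    refine mul_neg_of_pos_of_neg hi ?_
    have h5 : P.pairingIn ℤ (i : ι) k ≠ 0 := by
      intro h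
      apply hik
      rw [RootPairing.Base.cartanMatrix_apply_eq_zero_iff_symm]
      exact h
    have := b.pairingIn_le_zero_of_ne (fun h => hki (Subtype.ext h)) i.2 k.2
    exact_mod_cast lt_of_le_of_ne this h5
  rw [← h2] at h4
  have : P.pairingIn ℤ θ k < 0 := by exact_mod_cast h4
  omega

/-- A positive root that is not dominant can be increased by a simple root, so one climbs by
induction on the height gap. A dominant a ≠ θ pairs positively with θ, so θ - a is a root, of
nonnegative height and hence positive. -/
theorem rootCoef_le_highest [P.IsRootSystem] [P.IsReduced] [P.IsIrreducible] (b : P.Base) {θ : ι}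
    (hθ : ∀ k, b.height k ≤ b.height θ) (a : ι) (j : b.support) :
    rootCoef b a j ≤ rootCoef b θ j := by
  have hpos := height_max_pos b hθ
  generalize hn : (b.height θ - b.height a).toNat = n
  induction n using Nat.strong_induction_on generalizing a with
  | _ n ih =>
  by_cases ha : 0 < b.height a
  swap
  · have h0 := b.height_ne_zero a
    have h1 : 0 < b.height (P.reflectionPerm a a) := by rw [height_neg]; omega
    have h2 := rootCoef_nonneg b h1 j
    rw [rootCoef_neg] at h2
    have := rootCoef_nonneg b hpos j
    linarith
  by_cases hdom : ∃ i ∈ b.support, P.pairingIn ℤ a i < 0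
  · obtain ⟨i, hi, hai⟩ := hdom
    have hi1 := RootPairing.Base.height_one_of_mem_support hi
    obtain ⟨c, hc⟩ := P.root_add_root_mem_of_pairingIn_neg hai (by
      intro h
      rw [← root_neg] at h
      have := P.root.injective h
      rw [this, height_neg] at ha
      omega)
    have hch := b.height_add hc
    have hcθ := hθ c
    have h1 := ih _ (by omega) c rfl
    rw [rootCoef_of_root_eq_add b hc] at h1
    have h2 := rootCoef_nonneg b (a := i) (by omega) j
    linarith
  · push Not at hdom
    by_cases haθ : a = θ
    · rw [haθ]
    obtain ⟨i, hi, hia⟩ := RootPairing.Base.IsPos.exists_mem_support_pos_pairingIn (b := b) ha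
    have h2 : 0 < (P.pairingIn ℤ θ a : ℝ) := by
      rw [pairing_eq_sum b]
      have hnn : ∀ k : b.support, 0 ≤ P.pairingIn ℤ (k : ι) a := by
        intro k
        by_contra! hk
        have := hdom k k.2
        have h3 : P.pairingIn ℤ a k < 0 := by
          by_contra! h4
          rcases h4.lt_or_eq with h5 | h5
          · rw [P.zero_lt_pairingIn_iff'] at h5
            omega
          · rw [eq_comm, P.pairingIn_eq_zero_iff] at h5
            omega
        omega
      refine Finset.sum_pos' (fun k _ => mul_nonneg (rootCoef_nonneg b hpos k) ?_)
        ⟨⟨i, hi⟩, Finset.mem_univ _, mul_pos (rootCoef_highest_pos b hθ _) ?_⟩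
      · exact_mod_cast hnn k
      · exact_mod_cast hia
    obtain ⟨c, hc⟩ := P.root_sub_root_mem_of_pairingIn_pos (by exact_mod_cast h2) (Ne.symm haθ)
    have hch := b.height_sub hc
    have h3 := hθ a
    have h4 := b.height_ne_zero c
    have h5 := rootCoef_nonneg b (a := c) (by omega) j
    have h6 := rootCoef_of_root_eq_add b (a := a) (c := c) (d := θ) (by rw [hc]; abel) j
    linarith

theorem eq_highest_of_height_eq [P.IsRootSystem] [P.IsReduced] [P.IsIrreducible] (b : P.Base)
    {θ : ι} (hθ : ∀ k, b.height k ≤ b.height θ) {a : ι} (ha : b.height a = b.height θ) :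
    a = θ := by
  refine rootCoef_injective b fun j => ?_
  have h1 : ∑ j, rootCoef b a j = ∑ j, rootCoef b θ j := by
    rw [← height_eq_sum_rootCoef, ← height_eq_sum_rootCoef, ha]
  exact (Finset.sum_eq_sum_iff_of_le fun j _ => rootCoef_le_highest b hθ a j).1 h1 j
    (Finset.mem_univ _)

/-- A pairing of at least 2 would let s_θ lower the height by at least 2l; as all heights lie in
[-l, l], this leaves only a = θ. -/
theorem pairing_highest_le_one [P.IsRootSystem] [P.IsReduced] [P.IsIrreducible] (b : P.Base)
    {θ : ι} (hθ : ∀ k, b.height k ≤ b.height θ) {a : ι} (ha : a ≠ θ) :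
    P.pairingIn ℤ a θ ≤ 1 := by
  by_contra! h
  have h1 := neg_height_le b hθ (P.reflectionPerm θ a)
  have h2 := hθ a
  have hpos := height_max_pos b hθ
  rw [height_reflectionPerm] at h1
  refine ha (eq_highest_of_height_eq b hθ ?_)
  nlinarith

theorem neg_one_le_pairing_highest [P.IsRootSystem] [P.IsReduced] [P.IsIrreducible] (b : P.Base)
    {θ : ι} (hθ : ∀ k, b.height k ≤ b.height θ) {a : ι} (ha : a ≠ P.reflectionPerm θ θ) :
    -1 ≤ P.pairingIn ℤ a θ := by
  have h := pairing_highest_le_one b hθ (a := P.reflectionPerm a a) (by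
    intro h
    apply ha
    apply P.root.injective
    rw [root_neg, ← h, root_neg, neg_neg])
  rw [P.pairingIn_reflectionPerm_self_left] at h
  omega

/-- The pairing of a positive root with the highest coroot is nonnegative. -/
theorem pairing_highest_nonneg_of_pos [P.IsRootSystem] (b : P.Base) {θ : ι}
    (hθ : ∀ k, b.height k ≤ b.height θ) {a : ι} (ha : 0 < b.height a) :
    0 ≤ P.pairingIn ℤ a θ := by
  have : 0 ≤ (P.pairingIn ℤ a θ : ℝ) := by
    rw [pairing_eq_sum b]
    refine Finset.sum_nonneg fun j _ => mul_nonneg (rootCoef_nonneg b ha j) ?_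
    have h1 := pairing_highest_nonneg b hθ j.2
    have : 0 ≤ P.pairingIn ℤ (j : ι) θ := by
      by_contra! hk
      rcases h1.lt_or_eq with h5 | h5
      · rw [P.zero_lt_pairingIn_iff'] at h5
        omega
      · rw [eq_comm, P.pairingIn_eq_zero_iff] at h5
        omega
    exact_mod_cast this
  exact_mod_cast this

/-- Some simple root α_j pairs positively with a; if a ≠ α_j then a - α_j is a root of height 0,
which does not exist. -/
theorem mem_support_of_height_eq_one [P.IsRootSystem] (b : P.Base) {a : ι}
    (ha : b.height a = 1) : a ∈ b.support := by
  have hpos : b.IsPos a := by rw [RootPairing.Base.isPos_iff]; omega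
  obtain ⟨j, hj, hj'⟩ := hpos.exists_mem_support_pos_pairingIn
  rw [P.zero_lt_pairingIn_iff'] at hj'
  by_contra h
  obtain ⟨k, hk⟩ := P.root_sub_root_mem_of_pairingIn_pos hj' (by rintro rfl; exact h hj)
  have := b.height_sub hk
  rw [RootPairing.Base.height_one_of_mem_support hj] at this
  exact b.height_ne_zero k (by omega)

end FiniteFacts

/-! ### Affine roots, the action of the affine Weyl group, and configurations as functionals. -/

section AffineAction

variable {ι M N : Type*} [AddCommGroup M] [Module ℝ M] [AddCommGroup N] [Module ℝ N]
  {P : RootPairing ι ℝ M N}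

/-- The coefficient of the imaginary root `δ` in the affine simple root of a vertex. -/
def imagCoef {α : Type*} : Option α → ℤ
  | none => 1
  | some _ => 0

/-- The affine simple roots; the pair `(a, k)` stands for the affine root `a + kδ`. -/
def affSimple (b : P.Base) (θ : ι) (i : Option b.support) : ι × ℤ :=
  (extRoot b θ i, imagCoef i)

/-- The negative of an affine root. -/
def affNeg (P : RootPairing ι ℝ M N) (β : ι × ℤ) : ι × ℤ := (P.reflectionPerm β.1 β.1, -β.2)

/-- Positivity of affine roots. -/
def AffPos (b : P.Base) (β : ι × ℤ) : Prop := 0 < β.2 ∨ (β.2 = 0 ∧ 0 < b.height β.1)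

/-- The level of a configuration. -/
noncomputable def level [P.IsRootSystem] (b : P.Base) (θ : ι) (v : Option b.support → ℝ) : ℝ :=
  ∑ i, extDelta b θ i * v i

/-- The linear functional on the finite root system determined by the values of a configuration
at the simple roots. -/
noncomputable def finEval [P.IsRootSystem] (b : P.Base) (v : Option b.support → ℝ) (a : ι) : ℝ :=
  ∑ j, rootCoef b a j * v (some j)

/-- The value of a configuration at an affine root. -/
noncomputable def affEval [P.IsRootSystem] (b : P.Base) (θ : ι) (v : Option b.support → ℝ)
    (β : ι × ℤ) : ℝ :=
  finEval b v β.1 + β.2 * level b θ v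

theorem affNeg_affNeg (β : ι × ℤ) : affNeg P (affNeg P β) = β := by
  ext
  · apply P.root.injective
    simp only [affNeg, root_neg, neg_neg]
  · simp [affNeg]

theorem affPos_affNeg_iff (b : P.Base) (β : ι × ℤ) : AffPos b (affNeg P β) ↔ ¬ AffPos b β := by
  have := b.height_ne_zero β.1
  simp only [AffPos, affNeg, height_neg]
  omega

theorem finEval_neg [P.IsRootSystem] (b : P.Base) (v : Option b.support → ℝ) (a : ι) :
    finEval b v (P.reflectionPerm a a) = -finEval b v a := by
  simp [finEval, rootCoef_neg]

theorem affEval_neg [P.IsRootSystem] (b : P.Base) (θ : ι) (v : Option b.support → ℝ)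
    (β : ι × ℤ) : affEval b θ v (affNeg P β) = -affEval b θ v β := by
  simp [affEval, affNeg, finEval_neg]; ring

theorem finEval_simple [P.IsRootSystem] (b : P.Base) (v : Option b.support → ℝ) (j : b.support) :
    finEval b v j = v (some j) := by
  classical
  simp only [finEval, rootCoef_simple]
  rw [Finset.sum_eq_single j] <;> simp +contextual [eq_comm]

theorem level_eq [P.IsRootSystem] (b : P.Base) (θ : ι) (v : Option b.support → ℝ) :
    level b θ v = v none + finEval b v θ := by
  simp [level, finEval, extDelta, Fintype.sum_option, rootCoef]

theorem affEval_simple [P.IsRootSystem] (b : P.Base) (θ : ι) (v : Option b.support → ℝ)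
    (i : Option b.support) : affEval b θ v (affSimple b θ i) = v i := by
  cases i with
  | none => simp [affEval, affSimple, extRoot, imagCoef, finEval_neg, level_eq]
  | some j => simp [affEval, affSimple, extRoot, imagCoef, finEval_simple]

variable [P.IsCrystallographic]

/-- The action of the simple reflections on affine roots. -/
noncomputable def affRefl (b : P.Base) (θ : ι) (i : Option b.support) (β : ι × ℤ) : ι × ℤ :=
  (P.reflectionPerm (extRoot b θ i) β.1,
    β.2 - P.pairingIn ℤ β.1 (extRoot b θ i) * imagCoef i)

/-- The action of products of simple reflections on affine roots. -/
noncomputable def affAct (b : P.Base) (θ : ι) : List (Option b.support) → ι × ℤ → ι × ℤ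
  | [], β => β
  | i :: L, β => affRefl b θ i (affAct b θ L β)

theorem affAct_append (b : P.Base) (θ : ι) (L L' : List (Option b.support)) (β : ι × ℤ) :
    affAct b θ (L ++ L') β = affAct b θ L (affAct b θ L' β) := by
  induction L with
  | nil => rfl
  | cons i L ih => simp [affAct, ih]

theorem affRefl_affRefl (b : P.Base) (θ : ι) (i : Option b.support) (β : ι × ℤ) :
    affRefl b θ i (affRefl b θ i β) = β := by
  ext
  · simp [affRefl]
  · simp only [affRefl, ← P.pairingIn_reflectionPerm, P.pairingIn_reflectionPerm_self_right]
    ring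

theorem affAct_injective (b : P.Base) (θ : ι) (L : List (Option b.support)) :
    Function.Injective (affAct b θ L) := by
  induction L with
  | nil => exact fun _ _ h => h
  | cons i L ih =>
    intro β γ h
    apply ih
    rw [← affRefl_affRefl b θ i (affAct b θ L β), ← affRefl_affRefl b θ i (affAct b θ L γ)]
    exact congrArg _ h

theorem affRefl_neg (b : P.Base) (θ : ι) (i : Option b.support) (β : ι × ℤ) :
    affRefl b θ i (affNeg P β) = affNeg P (affRefl b θ i β) := by
  ext
  · apply P.root.injective
    rw [affRefl, affNeg, affNeg, P.root_reflectionPerm, root_neg, map_neg, root_neg, affRefl,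
      P.root_reflectionPerm]
  · simp only [affRefl, affNeg, P.pairingIn_reflectionPerm_self_left]
    ring

theorem affAct_neg (b : P.Base) (θ : ι) (L : List (Option b.support)) (β : ι × ℤ) :
    affAct b θ L (affNeg P β) = affNeg P (affAct b θ L β) := by
  induction L with
  | nil => rfl
  | cons i L ih => simp [affAct, ih, affRefl_neg]

theorem affRefl_simple (b : P.Base) (θ : ι) (i : Option b.support) :
    affRefl b θ i (affSimple b θ i) = affNeg P (affSimple b θ i) := by
  ext
  · simp [affRefl, affSimple, affNeg]
  · simp only [affRefl, affSimple, affNeg, P.pairingIn_same]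
    ring

theorem pairingIn_affAct (b : P.Base) (θ : ι) (L : List (Option b.support)) (β γ : ι × ℤ) :
    P.pairingIn ℤ (affAct b θ L β).1 (affAct b θ L γ).1 = P.pairingIn ℤ β.1 γ.1 := by
  induction L with
  | nil => rfl
  | cons i L ih => simp [affAct, affRefl, P.pairingIn_reflectionPerm, ih]

theorem root_affAct_add (b : P.Base) (θ : ι) (L : List (Option b.support)) {β γ ε : ι × ℤ}
    (h₁ : P.root ε.1 = P.root β.1 + P.root γ.1) (h₂ : ε.2 = β.2 + γ.2) :
    P.root (affAct b θ L ε).1 = P.root (affAct b θ L β).1 + P.root (affAct b θ L γ).1 ∧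
      (affAct b θ L ε).2 = (affAct b θ L β).2 + (affAct b θ L γ).2 := by
  induction L with
  | nil => exact ⟨h₁, h₂⟩
  | cons i L ih =>
    simp only [affAct, affRefl, P.root_reflectionPerm, ih.1, map_add, true_and]
    rw [P.pairingIn_eq_add_of_root_eq_add ih.1, ih.2]
    ring

/-- The inverse of the action of a list is the action of the reversed list. -/
theorem affAct_reverse (b : P.Base) (θ : ι) (L : List (Option b.support)) (β : ι × ℤ) :
    affAct b θ L (affAct b θ L.reverse β) = β := by
  induction L generalizing β with
  | nil => rfl
  | cons i L ih => simp [affAct, affAct_append, ih, affRefl_affRefl]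

theorem extCartan_cast_eq [P.IsRootSystem] (b : P.Base) (θ : ι) (i : Option b.support) (a : ι) :
    ∑ j : b.support, rootCoef b a j * (extCartan b θ i (some j) : ℝ) =
      P.pairingIn ℤ a (extRoot b θ i) := by
  rw [pairing_eq_sum b]; rfl

theorem finEval_reflectionPerm [P.IsRootSystem] (b : P.Base) (v : Option b.support → ℝ)
    (a c : ι) : finEval b v (P.reflectionPerm c a) =
      finEval b v a - P.pairingIn ℤ a c * finEval b v c := by
  simp only [finEval, rootCoef_reflectionPerm, Finset.mul_sum, ← Finset.sum_sub_distrib]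
  exact Finset.sum_congr rfl fun j _ => by ring

theorem finEval_fire [P.IsRootSystem] (b : P.Base) (θ : ι) (v : Option b.support → ℝ)
    (i : Option b.support) (a : ι) : finEval b (fire (extCartan b θ) i v) a =
      finEval b v a - P.pairingIn ℤ a (extRoot b θ i) * v i := by
  rw [← extCartan_cast_eq, Finset.sum_mul]
  simp only [finEval, fire, ← Finset.sum_sub_distrib]
  exact Finset.sum_congr rfl fun j _ => by ring

theorem level_fire [P.IsRootSystem] (b : P.Base) (θ : ι) (v : Option b.support → ℝ)
    (i : Option b.support) : level b θ (fire (extCartan b θ) i v) = level b θ v := by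
  rw [level_eq, level_eq, finEval_fire]
  simp [fire, extCartan, extRoot]

theorem level_play [P.IsRootSystem] (b : P.Base) (θ : ι) (v : Option b.support → ℝ)
    (L : List (Option b.support)) : level b θ (play (extCartan b θ) v L) = level b θ v := by
  induction L generalizing v with
  | nil => rfl
  | cons i L ih => rw [play, ih, level_fire]

/-- This duality between firing and simple reflections turns the game into a question about affine
roots. -/
theorem affEval_fire [P.IsRootSystem] (b : P.Base) (θ : ι) (v : Option b.support → ℝ)
    (i : Option b.support) (β : ι × ℤ) :
    affEval b θ (fire (extCartan b θ) i v) β = affEval b θ v (affRefl b θ i β) := by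
  have h := affEval_simple b θ v i
  simp only [affEval, affSimple] at h
  simp only [affEval, level_fire, finEval_fire, affRefl, finEval_reflectionPerm]
  rw [← h]
  push_cast
  ring

theorem affEval_play [P.IsRootSystem] (b : P.Base) (θ : ι) (v : Option b.support → ℝ)
    (L : List (Option b.support)) (β : ι × ℤ) :
    affEval b θ (play (extCartan b θ) v L) β = affEval b θ v (affAct b θ L β) := by
  induction L generalizing v with
  | nil => rfl
  | cons i L ih => rw [play, ih, affEval_fire, affAct]

theorem play_apply [P.IsRootSystem] (b : P.Base) (θ : ι) (v : Option b.support → ℝ)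
    (L : List (Option b.support)) (i : Option b.support) :
    play (extCartan b θ) v L i = affEval b θ v (affAct b θ L (affSimple b θ i)) := by
  rw [← affEval_play, affEval_simple]

theorem affPos_simple (b : P.Base) (θ : ι) (i : Option b.support) :
    AffPos b (affSimple b θ i) := by
  cases i with
  | none => left; simp [affSimple, imagCoef]
  | some j =>
    right
    simp only [affSimple, imagCoef, extRoot, true_and]
    exact RootPairing.Base.isPos_of_mem_support j.2

variable [P.IsRootSystem] [P.IsReduced] [P.IsIrreducible] [Finite ι]

/-- A simple reflection permutes the positive affine roots other than its simple root. -/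
theorem AffPos.affRefl (b : P.Base) {θ : ι} (hθ : ∀ k, b.height k ≤ b.height θ)
    {i : Option b.support} {β : ι × ℤ} (hβ : AffPos b β) (hne : β ≠ affSimple b θ i) :
    AffPos b (affRefl b θ i β) := by
  obtain ⟨a, k⟩ := β
  have hpos := height_max_pos b hθ
  cases i with
  | some j =>
    rcases hβ with h | ⟨h, h'⟩
    · left; simpa [_root_.affRefl, imagCoef] using h
    · right
      refine ⟨by simpa [_root_.affRefl, imagCoef] using h, ?_⟩
      refine RootPairing.Base.IsPos.reflectionPerm (b := b) h' j.2 ?_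
      rintro rfl
      exact hne (by simp only at h; simp [affSimple, extRoot, imagCoef, h])
  | none =>
    simp only [AffPos, _root_.affRefl, extRoot, imagCoef,
      P.pairingIn_reflectionPerm_self_right] at hβ ⊢
    have hr : P.reflectionPerm (P.reflectionPerm θ θ) a = P.reflectionPerm θ a := by
      apply P.root.injective
      rw [root_reflectionPerm_eq, root_neg, root_reflectionPerm_eq,
        P.pairingIn_reflectionPerm_self_right]
      simp
    rw [hr, height_reflectionPerm]
    rcases hβ with h | ⟨h, h'⟩
    · by_cases ha : a = P.reflectionPerm θ θ
      · have hk : k ≠ 1 := by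
          rintro rfl
          exact hne (by simp [affSimple, extRoot, imagCoef, ha])
        have h1 : P.pairingIn ℤ a θ = -2 := by
          rw [ha, P.pairingIn_reflectionPerm_self_left, P.pairingIn_same]
        rw [h1, ha, height_neg]
        omega
      · have h1 := neg_one_le_pairing_highest b hθ ha
        have h2 := neg_height_le b hθ (P.reflectionPerm θ a)
        have h3 := b.height_ne_zero (P.reflectionPerm θ a)
        have h4 := neg_height_le b hθ a
        have h5 := b.height_ne_zero a
        -- The reflection turns k into k + ⟨a, θ^∨⟩ ≥ k - 1. In the borderline case k = 1 the finite
        -- part becomes a + θ, of height ≥ 0 and therefore > 0.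
        by_cases h6 : P.pairingIn ℤ a θ = -1
        · have h7 : b.height (P.reflectionPerm θ a) = b.height a + b.height θ := by
            rw [height_reflectionPerm, h6]; ring
          rw [h6]
          omega
        · left; omega
    · have h1 := pairing_highest_nonneg_of_pos b hθ h'
      rcases h1.lt_or_eq with h2 | h2
      · left; omega
      · right
        rw [← h2]
        omega

/-- For a finite simple root both imaginary parts vanish and two positive heights would add up to 1.
For `none` one part is 1 and the other 0, so the heights add up to at least -l + 1 instead of -l. -/
theorem affSimple_ne_add (b : P.Base) {θ : ι} (hθ : ∀ k, b.height k ≤ b.height θ)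
    (i : Option b.support) {β γ : ι × ℤ} (hβ : AffPos b β) (hγ : AffPos b γ)
    (h₁ : P.root (affSimple b θ i).1 = P.root β.1 + P.root γ.1)
    (h₂ : (affSimple b θ i).2 = β.2 + γ.2) : False := by
  have h := b.height_add h₁
  have hβ' := neg_height_le b hθ β.1
  have hγ' := neg_height_le b hθ γ.1
  unfold AffPos at hβ hγ
  cases i with
  | none =>
    simp only [affSimple, extRoot, imagCoef, height_neg] at h h₂
    omega
  | some j =>
    simp only [affSimple, extRoot, imagCoef, RootPairing.Base.height_one_of_mem_support j.2] at h h₂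
    omega

end AffineAction

/-! ### Linearity of play, and the row lattice. -/

section PlayLemmas

variable {I : Type*} (C : Matrix I I ℤ)

theorem isFiringSeq_append_singleton (t : ℝ) (v : I → ℝ) (L : List I) (i : I) :
    IsFiringSeq C t v (L ++ [i]) ↔ IsFiringSeq C t v L ∧ play C v L i < t := by
  induction L generalizing v with
  | nil => simp [IsFiringSeq, play]
  | cons j L ih => simp [IsFiringSeq, play, ih, and_assoc]

theorem play_add_smul (κ : ℝ) (v w : I → ℝ) (L : List I) :
    play C (v + κ • w) L = play C v L + κ • play C w L := by
  induction L generalizing v w with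
  | nil => rfl
  | cons i L ih =>
    have : fire C i (v + κ • w) = fire C i v + κ • fire C i w := by
      funext j; simp [fire]; ring
    rw [play, this, ih]; rfl

theorem play_neg (v : I → ℝ) (L : List I) : play C (-v) L = -play C v L := by
  induction L generalizing v with
  | nil => rfl
  | cons i L ih =>
    have : fire C i (-v) = -fire C i v := by
      funext j; simp [fire]; ring
    rw [play, this, ih]; rfl

/-- The lattice of configurations spanned by the rows of the matrix. -/
def rowLattice : AddSubgroup (I → ℝ) :=
  AddSubgroup.closure (Set.range fun i j => (C i j : ℝ))

theorem row_mem_rowLattice (i : I) : (fun j => (C i j : ℝ)) ∈ rowLattice C :=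
  AddSubgroup.subset_closure ⟨i, rfl⟩

/-- Firing does not change the class of an integral configuration modulo the row lattice. -/
theorem play_sub_mem_rowLattice (v : I → ℝ) (hv : ∀ i, ∃ n : ℤ, v i = n) (L : List I) :
    play C v L - v ∈ rowLattice C := by
  induction L generalizing v with
  | nil => simp [play]
  | cons i L ih =>
    obtain ⟨n, hn⟩ := hv i
    have h1 : fire C i v - v = -(n • fun j => (C i j : ℝ)) := by
      funext j; simp [fire, hn]; ring
    have h2 : fire C i v - v ∈ rowLattice C := by
      rw [h1]
      exact neg_mem (zsmul_mem (row_mem_rowLattice C i) n)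
    have h3 := ih (fire C i v) fun j => by
      obtain ⟨m, hm⟩ := hv j
      exact ⟨m - C i j * n, by simp [fire, hm, hn]⟩
    have := add_mem h3 h2
    rwa [sub_add_sub_cancel] at this

end PlayLemmas

/-! ### Termination and inversions. -/

section Game

variable {ι M N : Type*} [AddCommGroup M] [Module ℝ M] [AddCommGroup N] [Module ℝ N]
  {P : RootPairing ι ℝ M N} [P.IsCrystallographic]
  [P.IsRootSystem] [P.IsReduced] [P.IsIrreducible] [Finite ι]

/-- The positive affine roots at which a configuration is negative. -/
def negSet (b : P.Base) (θ : ι) (u : Option b.support → ℝ) : Set (ι × ℤ) :=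
  {β | AffPos b β ∧ affEval b θ u β < 0}

/-- The finite part of the value is bounded and each δ adds the positive level, so k is bounded
above. -/
theorem finite_negSet (b : P.Base) (θ : ι) (u : Option b.support → ℝ) (hu : 0 < level b θ u) :
    (negSet b θ u).Finite := by
  obtain ⟨B, hB⟩ := (Set.finite_range fun a => -finEval b u a / level b θ u).bddAbove
  refine ((Set.finite_univ (α := ι)).prod (Set.finite_Icc 0 ⌈B⌉)).subset ?_
  rintro ⟨a, k⟩ ⟨h1, h2⟩
  have h3 : -finEval b u a / level b θ u ≤ B := hB ⟨a, rfl⟩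
  rw [div_le_iff₀ hu] at h3
  have h4 : (k : ℝ) < B := by
    simp only [affEval] at h2
    nlinarith
  refine ⟨trivial, ?_, ?_⟩
  · rcases h1 with h | ⟨h, -⟩
    · exact h.le
    · exact h.ge
  · have : (k : ℝ) ≤ ⌈B⌉ := h4.le.trans (Int.le_ceil B)
    exact_mod_cast this

/-- The reflection s_i injects the new set into the old one and misses α_i, which belongs to the old
one. -/
theorem ncard_negSet_fire_lt (b : P.Base) {θ : ι} (hθ : ∀ k, b.height k ≤ b.height θ)
    (u : Option b.support → ℝ) (hu : 0 < level b θ u) {i : Option b.support} (hi : u i < 0) :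
    (negSet b θ (fire (extCartan b θ) i u)).ncard < (negSet b θ u).ncard := by
  have hmem : affSimple b θ i ∈ negSet b θ u :=
    ⟨affPos_simple b θ i, by rwa [affEval_simple]⟩
  have hfin := finite_negSet b θ u hu
  rw [← Set.ncard_sdiff_singleton_add_one hmem hfin, Nat.lt_succ_iff]
  refine Set.ncard_le_ncard_of_injOn (affRefl b θ i) ?_ ?_ hfin.sdiff
  · rintro β ⟨h1, h2⟩
    rw [affEval_fire] at h2
    have hne : β ≠ affSimple b θ i := by
      rintro rfl
      rw [affRefl_simple, affEval_neg, affEval_simple] at h2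
      linarith
    refine ⟨⟨h1.affRefl b hθ hne, h2⟩, ?_⟩
    intro h
    have h3 := congrArg (affRefl b θ i) (Set.mem_singleton_iff.1 h)
    rw [affRefl_affRefl, affRefl_simple] at h3
    rw [h3, affPos_affNeg_iff] at h1
    exact h1 (affPos_simple b θ i)
  · intro β _ γ _ h
    rw [← affRefl_affRefl b θ i β, h, affRefl_affRefl]

theorem IsFiringSeq.length_le (b : P.Base) {θ : ι} (hθ : ∀ k, b.height k ≤ b.height θ)
    {u : Option b.support → ℝ} (hu : 0 < level b θ u) {L : List (Option b.support)}
    (hL : IsFiringSeq (extCartan b θ) 0 u L) : L.length ≤ (negSet b θ u).ncard := by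
  induction L generalizing u with
  | nil => simp
  | cons i L ih =>
    have h1 := ih (by rwa [level_fire]) hL.2
    have h2 := ncard_negSet_fire_lt b hθ u hu hL.1
    simp only [List.length_cons]
    omega

theorem exists_play_nonneg (b : P.Base) {θ : ι} (hθ : ∀ k, b.height k ≤ b.height θ)
    (u : Option b.support → ℝ) (hu : 0 < level b θ u) :
    ∃ L, ∀ i, 0 ≤ play (extCartan b θ) u L i := by
  generalize hn : (negSet b θ u).ncard = n
  induction n using Nat.strong_induction_on generalizing u with
  | _ n ih =>
  by_cases h : ∃ i, u i < 0
  · obtain ⟨i, hi⟩ := h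
    obtain ⟨L, hL⟩ := ih _ (hn ▸ ncard_negSet_fire_lt b hθ u hu hi) _ (by rwa [level_fire]) rfl
    exact ⟨i :: L, hL⟩
  · push Not at h
    exact ⟨[], h⟩

/-- The inversions of a valid firing sequence are affine roots at which the initial configuration
is negative. -/
theorem IsFiringSeq.affEval_neg_of_inversion (b : P.Base) {θ : ι}
    (hθ : ∀ k, b.height k ≤ b.height θ) {u : Option b.support → ℝ} {L : List (Option b.support)}
    (hL : IsFiringSeq (extCartan b θ) 0 u L) {γ : ι × ℤ} (hγ : ¬ AffPos b γ)
    (hγ' : AffPos b (affAct b θ L γ)) : affEval b θ u (affAct b θ L γ) < 0 := by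
  induction L generalizing u with
  | nil => exact absurd hγ' hγ
  | cons i L ih =>
    -- Either the tail has already made γ positive, or the first letter i does; in the latter case
    -- the resulting root is α_i, fired at a negative amplitude.
    by_cases h : AffPos b (affAct b θ L γ)
    · have := ih hL.2 h
      rwa [affEval_fire] at this
    · rw [← affPos_affNeg_iff] at h
      by_cases h1 : affNeg P (affAct b θ L γ) = affSimple b θ i
      · have h2 : affAct b θ (i :: L) γ = affSimple b θ i := by
          rw [affAct, ← affNeg_affNeg (P := P) (affAct b θ L γ), h1, affRefl_neg, affRefl_simple,
            affNeg_affNeg]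
        rw [h2, affEval_simple]
        exact hL.1
      · have h2 := h.affRefl b hθ h1
        rw [affRefl_neg, affPos_affNeg_iff] at h2
        exact absurd hγ' h2

end Game

/-! ### Values of ρ + κω, and the equivalence of the two firing rules. -/

section Rho

variable {ι M N : Type*} [AddCommGroup M] [Module ℝ M] [AddCommGroup N] [Module ℝ N]
  {P : RootPairing ι ℝ M N} [P.IsCrystallographic]
  [P.IsRootSystem] [P.IsReduced] [P.IsIrreducible] [Finite ι]

theorem extDelta_eq_intCast (b : P.Base) (θ : ι) (i : Option b.support) :
    ∃ n : ℤ, extDelta b θ i = n := by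
  cases i with
  | none => exact ⟨1, by simp [extDelta]⟩
  | some j =>
    obtain ⟨f, hf, -⟩ := rootCoef_eq_intCast b θ
    exact ⟨f j, hf j⟩

theorem one_le_extDelta (b : P.Base) {θ : ι} (hθ : ∀ k, b.height k ≤ b.height θ)
    (i : Option b.support) : 1 ≤ extDelta b θ i := by
  have hpos : 0 < extDelta b θ i := by
    cases i with
    | none => simp [extDelta]
    | some j => exact rootCoef_highest_pos b hθ j
  obtain ⟨n, hn⟩ := extDelta_eq_intCast b θ i
  rw [hn] at hpos ⊢
  have : 0 < n := by exact_mod_cast hpos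
  exact_mod_cast this

theorem sum_extDelta (b : P.Base) (θ : ι) : ∑ i, extDelta b θ i = b.height θ + 1 := by
  rw [Fintype.sum_option, height_eq_sum_rootCoef]
  simp [extDelta, rootCoef, add_comm]

theorem rhoVec_of_ne {I : Type*} [Fintype I] (δ : I → ℝ) {i j : I} (h : j ≠ i) :
    rhoVec δ i j = 1 := by
  simp [rhoVec, h]

theorem rhoVec_self (b : P.Base) (θ : ι) {p : Option b.support} (hp : extDelta b θ p = 1) :
    rhoVec (extDelta b θ) p p = -b.height θ := by
  classical
  have h := sum_mul_rhoVec (extDelta b θ) p (by rw [hp]; exact one_ne_zero)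
  have h2 := sum_extDelta b θ
  rw [← Finset.add_sum_erase _ _ (Finset.mem_univ p)] at h h2
  rw [Finset.sum_congr rfl fun j hj => by
    rw [rhoVec_of_ne _ (Finset.ne_of_mem_erase hj), mul_one]] at h
  rw [hp] at h h2
  linarith

theorem level_rhoVec (b : P.Base) (θ : ι) {p : Option b.support} (hp : extDelta b θ p = 1) :
    level b θ (rhoVec (extDelta b θ) p) = 0 :=
  sum_mul_rhoVec (extDelta b θ) p (by rw [hp]; exact one_ne_zero)

theorem extDelta_none (b : P.Base) (θ : ι) : extDelta b θ none = 1 := rfl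

theorem affEval_rhoVec_none (b : P.Base) (θ : ι) (β : ι × ℤ) :
    affEval b θ (rhoVec (extDelta b θ) none) β = b.height β.1 := by
  simp [affEval, level_rhoVec b θ (extDelta_none b θ), height_eq_sum_rootCoef, finEval,
    rhoVec_of_ne]

theorem level_omegaVec (b : P.Base) (θ : ι) (i : Option b.support) :
    level b θ (omegaVec i) = extDelta b θ i := by
  rw [level, Finset.sum_eq_single i] <;> simp +contextual [omegaVec]

theorem affEval_omegaVec_none (b : P.Base) (θ : ι) (β : ι × ℤ) :
    affEval b θ (omegaVec none) β = β.2 := by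
  simp [affEval, level_omegaVec, extDelta_none, finEval, omegaVec]

theorem affEval_add_smul (b : P.Base) (θ : ι) (κ : ℝ) (v w : Option b.support → ℝ) (β : ι × ℤ) :
    affEval b θ (v + κ • w) β = affEval b θ v β + κ * affEval b θ w β := by
  simp only [affEval, finEval, level, Pi.add_apply, Pi.smul_apply, smul_eq_mul, mul_add,
    Finset.sum_add_distrib, Finset.mul_sum]
  simp only [mul_left_comm κ]
  ring

theorem level_add_smul (b : P.Base) (θ : ι) (κ : ℝ) (v w : Option b.support → ℝ) :
    level b θ (v + κ • w) = level b θ v + κ * level b θ w := by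
  simp only [level, Pi.add_apply, Pi.smul_apply, smul_eq_mul, mul_add, Finset.sum_add_distrib,
    Finset.mul_sum]
  simp only [mul_left_comm κ]

theorem affEval_rhoVec_add_smul (b : P.Base) (θ : ι) (κ : ℝ) (β : ι × ℤ) :
    affEval b θ (rhoVec (extDelta b θ) none + κ • omegaVec none) β =
      b.height β.1 + κ * β.2 := by
  rw [affEval_add_smul, affEval_rhoVec_none, affEval_omegaVec_none]

theorem exists_eq_add_simple (b : P.Base) {a : ι} (ha : 2 ≤ b.height a) :
    ∃ c, ∃ j ∈ b.support, P.root a = P.root c + P.root j := by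
  have hpos : b.IsPos a := by rw [RootPairing.Base.isPos_iff]; omega
  obtain ⟨j, hj, hj'⟩ := hpos.exists_mem_support_pos_pairingIn
  rw [P.zero_lt_pairingIn_iff'] at hj'
  obtain ⟨k, hk⟩ := P.root_sub_root_mem_of_pairingIn_pos hj' (by
    rintro rfl
    rw [RootPairing.Base.height_one_of_mem_support hj] at ha
    omega)
  exact ⟨k, j, hj, by rw [hk]; abel⟩

/-- Along a valid firing sequence from `ρ + κω`, the negative amplitudes are the ones which are
`< -1` for the same sequence played from `ρ`. -/
theorem play_neg_iff_play_rhoVec_lt (b : P.Base) {θ : ι} (hθ : ∀ k, b.height k ≤ b.height θ)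
    {κ : ℝ} (hκ : 1 < κ) (hκ' : (κ - 1) * ((b.height θ : ℝ) - 1) < 1)
    {L : List (Option b.support)}
    (hL : IsFiringSeq (extCartan b θ) 0 (rhoVec (extDelta b θ) none + κ • omegaVec none) L)
    (i : Option b.support) :
    play (extCartan b θ) (rhoVec (extDelta b θ) none + κ • omegaVec none) L i < 0 ↔
      play (extCartan b θ) (rhoVec (extDelta b θ) none) L i < -1 := by
  rw [play_apply, play_apply, affEval_rhoVec_none, affEval_rhoVec_add_smul]
  have hinv := @IsFiringSeq.affEval_neg_of_inversion _ _ _ _ _ _ _ _ _ _ _ _ _ b θ hθ _ L hL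
  simp only [affEval_rhoVec_add_smul] at hinv
  have hnegs : ¬ AffPos b (affNeg P (affSimple b θ i)) := by
    rw [affPos_affNeg_iff, not_not]; exact affPos_simple b θ i
  generalize hβ : affAct b θ L (affSimple b θ i) = β
  -- If β = wα_i is negative, then -β = w(-α_i) is an inversion, where the initial configuration is
  -- negative.
  have hneg : ¬ AffPos b β → 0 < b.height β.1 + κ * (β.2 : ℝ) := by
    intro h
    rw [← affPos_affNeg_iff] at h
    have h2 := hinv hnegs (by rwa [affAct_neg, hβ])
    rw [affAct_neg, hβ] at h2
    simp only [affNeg, height_neg] at h2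
    push_cast at h2
    linarith
  constructor
  · intro h
    have hpos : AffPos b β := by
      by_contra h1
      have := hneg h1
      linarith
    rcases hpos with h1 | ⟨h1, h2⟩
    · have h3 : (1 : ℝ) ≤ β.2 := by exact_mod_cast h1
      nlinarith
    · rw [h1] at h
      have h3 : (0 : ℝ) < b.height β.1 := by exact_mod_cast h2
      simp only [Int.cast_zero, mul_zero, add_zero] at h
      linarith
  · intro h
    have hh : b.height β.1 < -1 := by exact_mod_cast h
    by_contra! hu
    by_cases hpos : AffPos b β
    · have hk : 0 < β.2 := by
        rcases hpos with h1 | ⟨h1, h2⟩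
        · exact h1
        · omega
      -- If k ≤ -ht - 1 ≤ l - 1, then ht + κk ≤ -1 + (κ - 1)(l - 1) < 0. The upper bound on κ is
      -- used here.
      have hkm : -b.height β.1 ≤ β.2 := by
        by_contra! hlt
        have h1 : (β.2 : ℝ) ≤ -b.height β.1 - 1 := by
          have : β.2 ≤ -b.height β.1 - 1 := by omega
          exact_mod_cast this
        have h2 : -(b.height β.1 : ℝ) - 1 ≤ b.height θ - 1 := by
          have h3 := neg_height_le b hθ β.1
          have : -b.height β.1 - 1 ≤ b.height θ - 1 := by omega
          exact_mod_cast this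
        nlinarith
      -- Since -a has height at least 2, write -a = c + α_j and split β as (-c, k - 1) + (-α_j, 1).
      -- Both summands are positive because k ≥ 2.
      obtain ⟨c, j, hj, hcj⟩ := exists_eq_add_simple b (a := P.reflectionPerm β.1 β.1)
        (by rw [height_neg]; omega)
      have hhc := b.height_add hcj
      rw [height_neg, RootPairing.Base.height_one_of_mem_support hj] at hhc
      -- A positive ε with w⁻¹ε negative would be an inversion, forcing a negative value at ε.
      have key : ∀ ε : ι × ℤ, 0 ≤ b.height ε.1 + κ * (ε.2 : ℝ) → AffPos b ε →
          AffPos b (affAct b θ L.reverse ε) := by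
        intro ε h1 h2
        by_contra h3
        have := hinv h3 (by rwa [affAct_reverse])
        rw [affAct_reverse] at this
        linarith
      have hκk : (β.2 : ℝ) - 1 ≤ κ * (β.2 - 1) := by
        have : (1 : ℝ) ≤ β.2 := by exact_mod_cast hk
        nlinarith
      have hkm' : -(b.height β.1 : ℝ) ≤ β.2 := by exact_mod_cast hkm
      have hβ₁ := key (P.reflectionPerm c c, β.2 - 1) (by
          have : (b.height (P.reflectionPerm c c) : ℝ) = b.height β.1 + 1 := by
            rw [height_neg]
            have : -b.height c = b.height β.1 + 1 := by omega
            exact_mod_cast this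
          rw [this]
          push_cast
          linarith)
        (by left; simp only; omega)
      have hβ₂ := key (P.reflectionPerm j j, 1) (by
          rw [height_neg, RootPairing.Base.height_one_of_mem_support hj]
          push_cast
          linarith)
        (by left; simp)
      have hs : affAct b θ L.reverse β = affSimple b θ i := by
        have := affAct_reverse b θ L.reverse (affSimple b θ i)
        rwa [List.reverse_reverse, hβ] at this
      have hadd := root_affAct_add b θ L.reverse
        (β := (P.reflectionPerm c c, β.2 - 1)) (γ := (P.reflectionPerm j j, 1)) (ε := β)
        (by
          simp only [root_neg]
          rw [← neg_add, ← hcj, root_neg, neg_neg])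
        (by simp)
      rw [hs] at hadd
      exact affSimple_ne_add b hθ i hβ₁ hβ₂ hadd.1 hadd.2
    · have h1 : β.2 ≤ 0 := by
        by_contra! h2
        exact hpos (Or.inl h2)
      have h2 : (β.2 : ℝ) ≤ 0 := by exact_mod_cast h1
      nlinarith

theorem isFiringSeq_iff (b : P.Base) {θ : ι} (hθ : ∀ k, b.height k ≤ b.height θ)
    {κ : ℝ} (hκ : 1 < κ) (hκ' : (κ - 1) * ((b.height θ : ℝ) - 1) < 1)
    (L : List (Option b.support)) :
    IsFiringSeq (extCartan b θ) 0 (rhoVec (extDelta b θ) none + κ • omegaVec none) L ↔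
      IsFiringSeq (extCartan b θ) (-1) (rhoVec (extDelta b θ) none) L := by
  induction L using List.reverseRecOn with
  | nil => simp [IsFiringSeq]
  | append_singleton L i ih =>
    rw [isFiringSeq_append_singleton, isFiringSeq_append_singleton, ← ih]
    exact and_congr_right fun h => play_neg_iff_play_rhoVec_lt b hθ hκ hκ' h i

end Rho

/-! ### Small elements of the coroot lattice. -/

section CorootLattice

variable {ι M N : Type*} [AddCommGroup M] [Module ℝ M] [AddCommGroup N] [Module ℝ N]
  {P : RootPairing ι ℝ M N} [P.IsCrystallographic] [Finite ι]

theorem coroot_add_mem_of_pairingIn_neg {a c : ι} (h : P.pairingIn ℤ a c < 0) :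
    P.coroot a + P.coroot c = 0 ∨ ∃ d, P.coroot a + P.coroot c = P.coroot d := by
  by_cases h0 : P.coroot a + P.coroot c = 0
  · exact Or.inl h0
  right
  have h1 : P.flip.pairingIn ℤ c a < 0 := by
    have : P.flip.pairingIn ℤ c a = P.pairingIn ℤ a c := by
      have h2 : ((P.flip.pairingIn ℤ c a : ℤ) : ℝ) = (P.pairingIn ℤ a c : ℤ) := by
        rw [pairingIn_cast, pairingIn_cast]; rfl
      exact_mod_cast h2
    rwa [this]
  obtain ⟨d, hd⟩ := P.flip.root_add_root_mem_of_pairingIn_neg h1 fun h2 =>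
    h0 (by
      have h3 : P.coroot c = -P.coroot a := h2
      rw [h3, add_neg_cancel])
  have hd' : P.coroot d = P.coroot c + P.coroot a := hd
  exact ⟨d, by rw [hd', add_comm]⟩

theorem exists_list_sum_coroot {y : N} (hy : y ∈ AddSubgroup.closure (Set.range P.coroot)) :
    ∃ l : List ι, y = (l.map P.coroot).sum := by
  induction hy using AddSubgroup.closure_induction with
  | mem x hx =>
    obtain ⟨a, rfl⟩ := hx
    exact ⟨[a], by simp⟩
  | zero => exact ⟨[], rfl⟩
  | add x y _ _ hx hy =>
    obtain ⟨l, rfl⟩ := hx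
    obtain ⟨l', rfl⟩ := hy
    exact ⟨l ++ l', by simp⟩
  | neg x hx' hx =>
    obtain ⟨l, rfl⟩ := hx
    clear hx'
    refine ⟨l.map fun a => P.reflectionPerm a a, ?_⟩
    induction l with
    | nil => simp
    | cons a l ih =>
      simp only [List.map_cons, List.sum_cons, neg_add, ih, P.coroot_reflectionPerm,
        P.coreflection_apply_self]

/-- An element of the coroot lattice pairing to at most one with all roots vanishes. -/
theorem eq_zero_of_forall_root_lt_two {y : N}
    (hy : y ∈ AddSubgroup.closure (Set.range P.coroot))
    (h : ∀ a, P.toLinearMap (P.root a) y < 2) : y = 0 := by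
  classical
  obtain ⟨l, hl⟩ := exists_list_sum_coroot hy
  generalize hn : l.length = n
  induction n using Nat.strong_induction_on generalizing l with
  | _ n ih =>
  cases l with
  | nil => simpa using hl
  | cons a l =>
    -- Two coroots with negative pairing merge into one coroot or cancel, giving a shorter
    -- expression. With no such partner for a, the whole sum pairs with a to at least 2.
    by_cases hc : ∃ c ∈ l, P.pairingIn ℤ a c < 0
    · obtain ⟨c, hcl, hc⟩ := hc
      have hperm := List.perm_cons_erase hcl
      have hsum : y = P.coroot a + P.coroot c + ((l.erase c).map P.coroot).sum := by
        rw [hl, List.map_cons, List.sum_cons, (hperm.map P.coroot).sum_eq, List.map_cons,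
          List.sum_cons, add_assoc]
      have hlen : (l.erase c).length + 1 = l.length := by
        rw [hperm.length_eq, List.length_cons]
      rw [List.length_cons] at hn
      rcases coroot_add_mem_of_pairingIn_neg hc with h0 | ⟨d, hd⟩
      · exact ih _ (by omega) (l.erase c) (by rw [hsum, h0, zero_add]) rfl
      · refine ih (l.erase c).length.succ (by omega) (d :: l.erase c) ?_ (by simp)
        rw [hsum, hd, List.map_cons, List.sum_cons]
    · push Not at hc
      exfalso
      have h1 : ∀ l : List ι, (∀ c ∈ l, 0 ≤ P.pairingIn ℤ a c) →
          0 ≤ P.toLinearMap (P.root a) (l.map P.coroot).sum := by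
        intro l hl
        induction l with
        | nil => simp
        | cons c l ih =>
          rw [List.map_cons, List.sum_cons, map_add]
          have h2 := ih fun d hd => hl d (List.mem_cons_of_mem _ hd)
          have h3 : 0 ≤ P.toLinearMap (P.root a) (P.coroot c) := by
            rw [P.root_coroot_eq_pairing, ← pairingIn_cast]
            exact_mod_cast hl c List.mem_cons_self
          linarith
      have h2 := h a
      rw [hl, List.map_cons, List.sum_cons, map_add, P.root_coroot_two] at h2
      linarith [h1 l hc]

end CorootLattice

/-! ### Level-one basis vectors modulo the row lattice. -/

section Minuscule

variable {ι M N : Type*} [AddCommGroup M] [Module ℝ M] [AddCommGroup N] [Module ℝ N]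
  {P : RootPairing ι ℝ M N} [P.IsCrystallographic]
  [P.IsRootSystem] [P.IsReduced] [P.IsIrreducible] [Finite ι]

/-- Each row of the extended Cartan matrix lists the pairings of one coroot with -θ and the simple
roots. -/
theorem exists_coroot_of_mem_rowLattice (b : P.Base) (θ : ι) {w : Option b.support → ℝ}
    (hw : w ∈ rowLattice (extCartan b θ)) :
    ∃ y ∈ AddSubgroup.closure (Set.range P.coroot),
      ∀ i, w i = P.toLinearMap (P.root (extRoot b θ i)) y := by
  induction hw using AddSubgroup.closure_induction with
  | mem x hx =>
    obtain ⟨i, rfl⟩ := hx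
    refine ⟨P.coroot (extRoot b θ i), AddSubgroup.subset_closure ⟨_, rfl⟩, fun j => ?_⟩
    rw [P.root_coroot_eq_pairing, ← pairingIn_cast]; rfl
  | zero => exact ⟨0, zero_mem _, by simp⟩
  | add x y _ _ hx hy =>
    obtain ⟨y₁, h₁, h₁'⟩ := hx
    obtain ⟨y₂, h₂, h₂'⟩ := hy
    exact ⟨y₁ + y₂, add_mem h₁ h₂, fun i => by simp [h₁', h₂']⟩
  | neg x _ hx =>
    obtain ⟨y₁, h₁, h₁'⟩ := hx
    exact ⟨-y₁, neg_mem h₁, fun i => by simp [h₁']⟩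

/-- The condition δ_i = 1 makes the fundamental coweight at i minuscule (or zero for `none`), since
coefficients of roots are bounded by those of θ. -/
theorem finEval_omegaVec_mem (b : P.Base) {θ : ι} (hθ : ∀ k, b.height k ≤ b.height θ)
    {i : Option b.support} (hi : extDelta b θ i = 1) {a : ι} (ha : 0 < b.height a) :
    0 ≤ finEval b (omegaVec i) a ∧ finEval b (omegaVec i) a ≤ 1 := by
  cases i with
  | none => simp [finEval, omegaVec]
  | some j =>
    have h : finEval b (omegaVec (some j)) a = rootCoef b a j := by
      rw [finEval, Finset.sum_eq_single j] <;> simp +contextual [omegaVec]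
    rw [h]
    exact ⟨rootCoef_nonneg b ha j, (rootCoef_le_highest b hθ a j).trans hi.le⟩

/-- Basis vectors of level one are determined by their class modulo the row lattice. -/
theorem eq_of_omegaVec_sub_mem (b : P.Base) {θ : ι} (hθ : ∀ k, b.height k ≤ b.height θ)
    {i j : Option b.support} (hi : extDelta b θ i = 1) (hj : extDelta b θ j = 1)
    (h : omegaVec i - omegaVec j ∈ rowLattice (extCartan b θ)) : i = j := by
  obtain ⟨y, hy, hy'⟩ := exists_coroot_of_mem_rowLattice b θ h
  have hev : ∀ a, P.toLinearMap (P.root a) y =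
      finEval b (omegaVec i) a - finEval b (omegaVec j) a := by
    intro a
    rw [← sum_rootCoef_smul b a, map_sum, LinearMap.sum_apply, finEval, finEval,
      ← Finset.sum_sub_distrib]
    refine Finset.sum_congr rfl fun k _ => ?_
    rw [map_smul, LinearMap.smul_apply, ← mul_sub, smul_eq_mul]
    exact congrArg _ (hy' (some k)).symm
  -- A difference of two functionals with values in [0, 1] on positive roots has values in [-1, 1]
  -- on all roots.
  have h0 : y = 0 := by
    refine eq_zero_of_forall_root_lt_two hy fun a => ?_
    rw [hev]
    by_cases ha : 0 < b.height a
    · have h1 := finEval_omegaVec_mem b hθ hi ha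
      have h2 := finEval_omegaVec_mem b hθ hj ha
      linarith
    · have ha' : 0 < b.height (P.reflectionPerm a a) := by
        have := b.height_ne_zero a
        rw [height_neg]; omega
      have h1 := finEval_omegaVec_mem b hθ hi ha'
      have h2 := finEval_omegaVec_mem b hθ hj ha'
      rw [finEval_neg] at h1 h2
      linarith
  have h1 := hy' i
  rw [h0, map_zero] at h1
  by_contra hij
  simp [omegaVec, hij] at h1

end Minuscule

/-! ### Terminal positions of the game. -/

section Endings

variable {ι M N : Type*} [AddCommGroup M] [Module ℝ M] [AddCommGroup N] [Module ℝ N]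
  {P : RootPairing ι ℝ M N} [P.IsCrystallographic]
  [P.IsRootSystem] [P.IsReduced] [P.IsIrreducible] [Finite ι]

/-- Configurations of level zero all of whose amplitudes, however they are played, are nonzero
integers bounded by the height of the highest root. -/
def HeightLike (b : P.Base) (θ : ι) (v : Option b.support → ℝ) : Prop :=
  level b θ v = 0 ∧ ∀ L i, ∃ n : ℤ, play (extCartan b θ) v L i = n ∧ n ≠ 0 ∧ |n| ≤ b.height θ

theorem heightLike_rhoVec_none (b : P.Base) {θ : ι} (hθ : ∀ k, b.height k ≤ b.height θ) :
    HeightLike b θ (rhoVec (extDelta b θ) none) := by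
  refine ⟨level_rhoVec b θ (extDelta_none b θ), fun L i => ?_⟩
  rw [play_apply, affEval_rhoVec_none]
  exact ⟨_, rfl, b.height_ne_zero _, abs_le.2 ⟨neg_height_le b hθ _, hθ _⟩⟩

theorem HeightLike.neg {b : P.Base} {θ : ι} {v : Option b.support → ℝ} (hv : HeightLike b θ v) :
    HeightLike b θ (-v) := by
  refine ⟨?_, fun L i => ?_⟩
  · have := hv.1
    simp only [level, Pi.neg_apply, mul_neg, Finset.sum_neg_distrib] at this ⊢
    rw [this, neg_zero]
  · obtain ⟨n, h1, h2, h3⟩ := hv.2 L i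
    exact ⟨-n, by simp [play_neg, h1], neg_ne_zero.2 h2, by rwa [abs_neg]⟩

theorem exists_eq_one_of_sum_eq_one {I : Type*} [Fintype I] (d : I → ℝ) (hd : ∀ i, 1 ≤ d i)
    (q : I → ℤ) (hq : ∀ i, 0 ≤ q i) (h : ∑ i, d i * q i = 1) :
    ∃ p, d p = 1 ∧ q p = 1 ∧ ∀ i, i ≠ p → q i = 0 := by
  classical
  obtain ⟨p, hp⟩ : ∃ p, 1 ≤ q p := by
    by_contra! h1
    have : ∑ i, d i * (q i : ℝ) = 0 := Finset.sum_eq_zero fun i _ => by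
      have : q i = 0 := by have := h1 i; have := hq i; omega
      simp [this]
    linarith
  have hp' : (1 : ℝ) ≤ q p := by exact_mod_cast hp
  have hnn : ∀ i, 0 ≤ d i * (q i : ℝ) := fun i =>
    mul_nonneg (by linarith [hd i]) (by exact_mod_cast hq i)
  rw [← Finset.add_sum_erase _ _ (Finset.mem_univ p)] at h
  have hrest : 0 ≤ ∑ i ∈ Finset.univ.erase p, d i * (q i : ℝ) :=
    Finset.sum_nonneg fun i _ => hnn i
  have hdp := hd p
  have h1 : d p * q p = 1 := by nlinarith
  have h2 : d p = 1 := by nlinarith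
  refine ⟨p, h2, ?_, fun i hi => ?_⟩
  · rw [h2, one_mul] at h1
    exact_mod_cast h1
  · have h3 : ∑ i ∈ Finset.univ.erase p, d i * (q i : ℝ) = 0 := by linarith
    rw [Finset.sum_eq_zero_iff_of_nonneg fun i _ => hnn i] at h3
    have h4 := h3 i (Finset.mem_erase.2 ⟨hi, Finset.mem_univ _⟩)
    have h5 := hd i
    rcases mul_eq_zero.1 h4 with h | h
    · linarith
    · exact_mod_cast h

/-- The difference v - ρ^(p) is coordinatewise nonnegative and has δ-weighted sum 0, with all
weights positive. -/
theorem eq_rhoVec_of_le (b : P.Base) {θ : ι} (hθ : ∀ k, b.height k ≤ b.height θ)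
    {p : Option b.support} (hp : extDelta b θ p = 1) {v : Option b.support → ℝ}
    (hv : level b θ v = 0) (h₁ : ∀ i, i ≠ p → 1 ≤ v i) (h₂ : -b.height θ ≤ v p) :
    v = rhoVec (extDelta b θ) p := by
  have h0 : ∑ i, extDelta b θ i * (v i - rhoVec (extDelta b θ) p i) = 0 := by
    have := level_rhoVec b θ hp
    simp only [level] at this hv
    simp only [mul_sub, Finset.sum_sub_distrib, this, hv, sub_zero]
  have hnn : ∀ i, 0 ≤ v i - rhoVec (extDelta b θ) p i := by
    intro i
    by_cases hi : i = p
    · rw [hi, rhoVec_self b θ hp]; linarith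
    · rw [rhoVec_of_ne _ hi]; linarith [h₁ i hi]
  have hd : ∀ i, 0 < extDelta b θ i := fun i => by linarith [one_le_extDelta b hθ i]
  rw [Finset.sum_eq_zero_iff_of_nonneg fun i _ => mul_nonneg (hd i).le (hnn i)] at h0
  funext i
  rcases mul_eq_zero.1 (h0 i (Finset.mem_univ i)) with h | h
  · exact absurd h (hd i).ne'
  · linarith

theorem play_omegaVec_none_eq (b : P.Base) (θ : ι) (L : List (Option b.support)) :
    ∃ k : Option b.support → ℤ, (∀ i, play (extCartan b θ) (omegaVec none) L i = k i) ∧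
      ∑ i, extDelta b θ i * (k i : ℝ) = 1 := by
  have h : ∀ i, play (extCartan b θ) (omegaVec none) L i =
      ((affAct b θ L (affSimple b θ i)).2 : ℝ) := fun i => by
    rw [play_apply, affEval_omegaVec_none]
  refine ⟨_, h, ?_⟩
  have h1 := level_play b θ (omegaVec none) L
  rw [level_omegaVec, extDelta_none] at h1
  simpa only [level, h] using h1

/-- The end of a game from `v + κω` with `κ` slightly larger than `1`. -/
theorem play_eq_of_nonneg_of_small (b : P.Base) {θ : ι} (hθ : ∀ k, b.height k ≤ b.height θ)
    {κ : ℝ} (hκ : 1 < κ) (hκ' : (κ - 1) * ((b.height θ : ℝ) - 1) < 1)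
    {v : Option b.support → ℝ} (hv : HeightLike b θ v) {L : List (Option b.support)}
    (hL : ∀ i, 0 ≤ play (extCartan b θ) (v + κ • omegaVec none) L i) :
    ∃ p, extDelta b θ p = 1 ∧
      play (extCartan b θ) v L = -rhoVec (extDelta b θ) p ∧
      play (extCartan b θ) (omegaVec none) L = omegaVec p + rhoVec (extDelta b θ) p := by
  obtain ⟨k, hk, hk1⟩ := play_omegaVec_none_eq b θ L
  choose h hh hh0 hhl using hv.2 L
  have hlev : level b θ (play (extCartan b θ) v L) = 0 := by rw [level_play, hv.1]
  have hlev' : ∑ i, extDelta b θ i * (h i : ℝ) = 0 := by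
    simpa only [level, hh] using hlev
  rw [play_add_smul] at hL
  simp only [Pi.add_apply, Pi.smul_apply, smul_eq_mul, hh, hk] at hL
  -- If h + k ≤ -1, then k ≤ l - 1 and h + κk ≤ -1 + (κ - 1)k < 0.
  have hq : ∀ i, 0 ≤ h i + k i := by
    intro i
    by_contra! hlt
    have h1 : (h i : ℝ) + k i ≤ -1 := by
      have : h i + k i ≤ -1 := by omega
      exact_mod_cast this
    have h2 := hL i
    have h3 := (abs_le.1 (hhl i)).1
    have h4 : (k i : ℝ) ≤ b.height θ - 1 := by
      have : k i ≤ b.height θ - 1 := by omega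
      exact_mod_cast this
    nlinarith
  obtain ⟨p, hp, hp1, hp0⟩ := exists_eq_one_of_sum_eq_one (extDelta b θ) (one_le_extDelta b hθ)
    (fun i => h i + k i) hq (by
      push_cast
      simp only [mul_add, Finset.sum_add_distrib, hlev', hk1, zero_add])
  have hv' : -play (extCartan b θ) v L = rhoVec (extDelta b θ) p := by
    refine eq_rhoVec_of_le b hθ hp ?_ (fun i hi => ?_) ?_
    · rw [← play_neg, level_play]
      exact hv.neg.1
    · have h1 := hp0 i hi
      have h2 := hL i
      -- Off p the amplitude is (1 - κ)h, so h ≤ 0; being a nonzero integer, h ≤ -1.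
      have h3 : (k i : ℝ) = -h i := by
        have : k i = -h i := by omega
        exact_mod_cast this
      rw [h3] at h2
      have h4 : h i ≤ 0 := by
        by_contra! h5
        have : (1 : ℝ) ≤ h i := by exact_mod_cast h5
        nlinarith
      have h5 := hh0 i
      have h6 : 1 ≤ -h i := by omega
      rw [Pi.neg_apply, hh]
      exact_mod_cast h6
    · have h1 := (abs_le.1 (hhl p)).2
      rw [Pi.neg_apply, hh, neg_le_neg_iff]
      exact_mod_cast h1
  refine ⟨p, hp, by rw [← hv', neg_neg], ?_⟩
  funext i
  rw [Pi.add_apply, ← hv', Pi.neg_apply, hh, hk]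
  have h1 : ((h i : ℝ) + k i) = omegaVec p i := by
    by_cases hi : i = p
    · have : (h i : ℝ) + k i = 1 := by rw [hi]; exact_mod_cast hp1
      rw [this]; simp [omegaVec, hi]
    · have : (h i : ℝ) + k i = 0 := by exact_mod_cast hp0 i hi
      rw [this]; simp [omegaVec, hi]
  linarith

/-- The end of a game from `v + κω` with `κ` large. -/
theorem play_eq_of_nonneg_of_large (b : P.Base) {θ : ι} (hθ : ∀ k, b.height k ≤ b.height θ)
    {v : Option b.support → ℝ} (hv : HeightLike b θ v) {L : List (Option b.support)}
    (hL : ∀ i, 0 ≤ play (extCartan b θ) (v + (b.height θ + 1 : ℝ) • omegaVec none) L i) :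
    ∃ p, extDelta b θ p = 1 ∧
      play (extCartan b θ) v L = rhoVec (extDelta b θ) p ∧
      play (extCartan b θ) (omegaVec none) L = omegaVec p := by
  obtain ⟨k, hk, hk1⟩ := play_omegaVec_none_eq b θ L
  choose h hh hh0 hhl using hv.2 L
  rw [play_add_smul] at hL
  simp only [Pi.add_apply, Pi.smul_apply, smul_eq_mul, hh, hk] at hL
  have hL' : ∀ i, 0 ≤ h i + (b.height θ + 1) * k i := fun i => by exact_mod_cast hL i
  have hpos := height_max_pos b hθ
  -- The factor l + 1 exceeds every |h|, so the sign of k decides.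
  have hq : ∀ i, 0 ≤ k i := by
    intro i
    by_contra! hlt
    have h2 := hL' i
    have h3 := (abs_le.1 (hhl i)).2
    nlinarith
  obtain ⟨p, hp, hp1, hp0⟩ := exists_eq_one_of_sum_eq_one (extDelta b θ) (one_le_extDelta b hθ)
    k hq hk1
  refine ⟨p, hp, eq_rhoVec_of_le b hθ hp (by rw [level_play, hv.1]) (fun i hi => ?_) ?_, ?_⟩
  · have h2 := hL' i
    rw [hp0 i hi, mul_zero, add_zero] at h2
    have h5 := hh0 i
    have h6 : 1 ≤ h i := by omega
    rw [hh]
    exact_mod_cast h6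
  · have h1 := (abs_le.1 (hhl p)).1
    rw [hh]
    exact_mod_cast h1
  · funext i
    rw [hk]
    by_cases hi : i = p
    · rw [hi, hp1]; simp [omegaVec]
    · rw [hp0 i hi]; simp [omegaVec, hi]

theorem exists_small (n : ℤ) (hn : 0 < n) : ∃ κ : ℝ, 1 < κ ∧ (κ - 1) * ((n : ℝ) - 1) < 1 := by
  have hn' : (0 : ℝ) < n := by exact_mod_cast hn
  -- The product becomes (n - 1)/n, which is below 1 also for n = 1.
  refine ⟨1 + 1 / n, by linarith [one_div_pos.2 hn'], ?_⟩
  rw [add_sub_cancel_left, one_div, mul_sub, inv_mul_cancel₀ hn'.ne']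
  linarith [inv_pos.2 hn']

theorem HeightLike.exists_play_eq_neg_rhoVec {b : P.Base} {θ : ι}
    (hθ : ∀ k, b.height k ≤ b.height θ) {v : Option b.support → ℝ} (hv : HeightLike b θ v) :
    ∃ L p, extDelta b θ p = 1 ∧
      play (extCartan b θ) v L = -rhoVec (extDelta b θ) p ∧
      play (extCartan b θ) (omegaVec none) L = omegaVec p + rhoVec (extDelta b θ) p := by
  obtain ⟨κ, hκ, hκ'⟩ := exists_small _ (height_max_pos b hθ)
  obtain ⟨L, hL⟩ := exists_play_nonneg b hθ (v + κ • omegaVec none) (by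
    rw [level_add_smul, hv.1, level_omegaVec, extDelta_none]; linarith)
  exact ⟨L, play_eq_of_nonneg_of_small b hθ hκ hκ' hv hL⟩

/-- A height-like configuration can be played to `ρ` of the vertex `none`. -/
theorem HeightLike.rhoVec_none_sub_mem {b : P.Base} {θ : ι} (hθ : ∀ k, b.height k ≤ b.height θ)
    {v : Option b.support → ℝ} (hv : HeightLike b θ v) :
    rhoVec (extDelta b θ) none - v ∈ rowLattice (extCartan b θ) := by
  obtain ⟨L, hL⟩ := exists_play_nonneg b hθ (v + (b.height θ + 1 : ℝ) • omegaVec none) (by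
    rw [level_add_smul, hv.1, level_omegaVec, extDelta_none]
    have : (0 : ℝ) < b.height θ := by exact_mod_cast height_max_pos b hθ
    linarith)
  obtain ⟨p, hp, h1, h2⟩ := play_eq_of_nonneg_of_large b hθ hv hL
  have h3 := play_sub_mem_rowLattice (extCartan b θ) (omegaVec none) (fun i => by
    by_cases h : i = none
    · exact ⟨1, by simp [omegaVec, h]⟩
    · exact ⟨0, by simp [omegaVec, h]⟩) L
  rw [h2] at h3
  -- The same game takes ω^(none) to ω^(p) within one class, so p = `none` and v has been played to
  -- ρ^(none).
  have h4 := eq_of_omegaVec_sub_mem b hθ hp (extDelta_none b θ) h3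
  have h5 := play_sub_mem_rowLattice (extCartan b θ) v (fun i => by
    obtain ⟨n, hn, -⟩ := hv.2 [] i
    exact ⟨n, hn⟩) L
  rwa [h1, h4] at h5

end Endings

/-! ### Transport of the game along graph automorphisms. -/

section Transport

variable {I : Type*} {C : Matrix I I ℤ} {τ : Equiv.Perm I}

theorem IsGraphAut.symm (hτ : IsGraphAut C τ) : IsGraphAut C τ.symm := fun i j => by
  rw [← hτ, τ.apply_symm_apply, τ.apply_symm_apply]

theorem IsGraphAut.fire_comp (hτ : IsGraphAut C τ) (i : I) (v : I → ℝ) :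
    fire C (τ i) (v ∘ τ.symm) = fire C i v ∘ τ.symm := by
  funext j
  have := hτ i (τ.symm j)
  rw [τ.apply_symm_apply] at this
  simp [fire, this]

theorem IsGraphAut.play_comp (hτ : IsGraphAut C τ) (v : I → ℝ) (L : List I) :
    play C (v ∘ τ.symm) L = play C v (L.map τ.symm) ∘ τ.symm := by
  induction L generalizing v with
  | nil => rfl
  | cons i L ih =>
    have := hτ.fire_comp (τ.symm i) v
    rw [τ.apply_symm_apply] at this
    rw [play, this, ih]; rfl

theorem IsGraphAut.isFiringSeq_comp (hτ : IsGraphAut C τ) (t : ℝ) (v : I → ℝ) (L : List I) :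
    IsFiringSeq C t (v ∘ τ.symm) L ↔ IsFiringSeq C t v (L.map τ.symm) := by
  induction L generalizing v with
  | nil => rfl
  | cons i L ih =>
    have := hτ.fire_comp (τ.symm i) v
    rw [τ.apply_symm_apply] at this
    rw [IsFiringSeq, this, ih]; rfl

theorem IsGraphAut.comp_mem_rowLattice (hτ : IsGraphAut C τ) {w : I → ℝ}
    (hw : w ∈ rowLattice C) : w ∘ τ.symm ∈ rowLattice C := by
  induction hw using AddSubgroup.closure_induction with
  | mem x hx =>
    obtain ⟨i, rfl⟩ := hx
    convert row_mem_rowLattice C (τ i) using 1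
    funext j
    have := hτ i (τ.symm j)
    rw [τ.apply_symm_apply] at this
    simp [this]
  | zero => exact zero_mem _
  | add x y _ _ hx hy => exact add_mem hx hy
  | neg x _ hx => exact neg_mem hx

theorem omegaVec_comp (τ : Equiv.Perm I) (i : I) : omegaVec i ∘ τ.symm = omegaVec (τ i) := by
  funext j
  by_cases h : j = τ i
  · simp [omegaVec, h]
  · have h' : τ.symm j ≠ i := by rwa [ne_eq, Equiv.symm_apply_eq]
    simp [omegaVec, h, h']

end Transport

/-! ### Graph automorphisms preserve δ and ρ. -/

section Automorphisms

variable {ι M N : Type*} [AddCommGroup M] [Module ℝ M] [AddCommGroup N] [Module ℝ N]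
  {P : RootPairing ι ℝ M N} [P.IsCrystallographic]
  [P.IsRootSystem] [P.IsReduced] [P.IsIrreducible] [Finite ι]

theorem sum_extCartan_mul_extDelta (b : P.Base) (θ : ι) (i : Option b.support) :
    ∑ j, (extCartan b θ i j : ℝ) * extDelta b θ j = 0 := by
  have h := extCartan_cast_eq b θ i θ
  simp only [mul_comm (rootCoef b θ _)] at h
  have h2 : ((extCartan b θ i none : ℤ) : ℝ) = -(P.pairingIn ℤ θ (extRoot b θ i) : ℝ) := by
    rw [extCartan, extRoot, P.pairingIn_reflectionPerm_self_left]; push_cast; rfl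
  rw [Fintype.sum_option, h2, extDelta_none, mul_one, ← h]
  exact neg_add_cancel _

/-- The null vectors of the extended Cartan matrix are the multiples of `δ`. -/
theorem eq_smul_extDelta (b : P.Base) (θ : ι) {d : Option b.support → ℝ}
    (hd : ∀ i, ∑ j, (extCartan b θ i j : ℝ) * d j = 0) (i : Option b.support) :
    d i = d none * extDelta b θ i := by
  -- A null vector makes x orthogonal to all simple coroots, so x = 0 is a linear relation between
  -- -θ and the simple roots.
  set x : M := ∑ j, d j • P.root (extRoot b θ j) with hx
  have h1 : P.toLinearMap x = 0 := by
    refine b.toCoweightBasis.ext fun k => ?_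
    rw [b.toCoweightBasis_apply, hx, map_sum, LinearMap.sum_apply, LinearMap.zero_apply,
      ← hd (some k)]
    refine Finset.sum_congr rfl fun j _ => ?_
    rw [map_smul, LinearMap.smul_apply, P.root_coroot_eq_pairing, ← pairingIn_cast, smul_eq_mul,
      mul_comm]
    rfl
  have h2 : x = 0 := by
    apply P.toPerfPair.injective
    rw [map_zero]
    exact h1
  cases i with
  | none => rw [extDelta_none, mul_one]
  | some k =>
    have h3 : b.toWeightBasis.repr x k = 0 := by rw [h2]; simp
    have h4 : ∑ j : b.support, d (some j) • P.root (j : ι) =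
        ∑ j, d (some j) • b.toWeightBasis j := by simp
    rw [hx, Fintype.sum_option] at h3
    simp only [extRoot] at h3
    rw [h4, map_add, Finsupp.add_apply, Module.Basis.repr_sum_self, root_neg] at h3
    simp only [map_smul, map_neg, Finsupp.smul_apply, Finsupp.neg_apply, smul_eq_mul] at h3
    simp only [extDelta]
    linarith

variable {b : P.Base} {θ : ι} {τ : Equiv.Perm (Option b.support)}

/-- The vector δ ∘ τ is again null, hence a multiple of δ; equal and nonzero coordinate sums make
the factor 1. -/
theorem IsGraphAut.extDelta_apply (hτ : IsGraphAut (extCartan b θ) τ)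
    (hθ : ∀ k, b.height k ≤ b.height θ) (i : Option b.support) :
    extDelta b θ (τ i) = extDelta b θ i := by
  have h1 := eq_smul_extDelta b θ (d := fun j => extDelta b θ (τ j)) (fun i => by
    refine Eq.trans (Finset.sum_congr rfl fun j _ => ?_) ((Equiv.sum_comp τ fun j =>
      (extCartan b θ (τ i) j : ℝ) * extDelta b θ j).trans
        (sum_extCartan_mul_extDelta b θ (τ i)))
    rw [hτ i j])
  have h2 : ∑ j, extDelta b θ (τ j) = ∑ j, extDelta b θ j := Equiv.sum_comp τ _
  rw [Finset.sum_congr rfl fun j _ => h1 j, ← Finset.mul_sum, sum_extDelta] at h2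
  have h3 : (0 : ℝ) < b.height θ := by exact_mod_cast height_max_pos b hθ
  have h4 : extDelta b θ (τ none) = 1 := by
    have : (extDelta b θ (τ none) - 1) * (b.height θ + 1) = 0 := by linarith
    rcases mul_eq_zero.1 this with h | h <;> linarith
  rw [h1 i, h4, one_mul]

theorem IsGraphAut.rhoVec_comp (hτ : IsGraphAut (extCartan b θ) τ)
    (hθ : ∀ k, b.height k ≤ b.height θ) {p : Option b.support} (hp : extDelta b θ p = 1) :
    rhoVec (extDelta b θ) p ∘ τ.symm = rhoVec (extDelta b θ) (τ p) := by
  funext j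
  by_cases hj : j = τ p
  · rw [hj, rhoVec_self b θ (by rw [hτ.extDelta_apply hθ, hp]), Function.comp_apply,
      τ.symm_apply_apply, rhoVec_self b θ hp]
  · rw [rhoVec_of_ne _ hj, Function.comp_apply, rhoVec_of_ne]
    rwa [ne_eq, Equiv.symm_apply_eq]

theorem IsGraphAut.heightLike_comp (hτ : IsGraphAut (extCartan b θ) τ)
    (hθ : ∀ k, b.height k ≤ b.height θ) {v : Option b.support → ℝ} (hv : HeightLike b θ v) :
    HeightLike b θ (v ∘ τ.symm) := by
  refine ⟨?_, fun L i => ?_⟩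
  · rw [← hv.1, level, level, ← Equiv.sum_comp τ]
    simp [hτ.extDelta_apply hθ]
  · rw [hτ.play_comp]
    exact hv.2 _ _

end Automorphisms

/-! ### The exchange condition in the affine Weyl group. -/

section Exchange

variable {ι M N : Type*} [AddCommGroup M] [Module ℝ M] [AddCommGroup N] [Module ℝ N]
  {P : RootPairing ι ℝ M N} [P.IsCrystallographic]

theorem root_affAct_add_zsmul (b : P.Base) (θ : ι) (L : List (Option b.support))
    {β γ ε : ι × ℤ} {n : ℤ} (h₁ : P.root ε.1 = P.root β.1 + n • P.root γ.1)
    (h₂ : ε.2 = β.2 + n * γ.2) :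
    P.root (affAct b θ L ε).1 = P.root (affAct b θ L β).1 + n • P.root (affAct b θ L γ).1 ∧
      (affAct b θ L ε).2 = (affAct b θ L β).2 + n * (affAct b θ L γ).2 := by
  induction L with
  | nil => exact ⟨h₁, h₂⟩
  | cons i L ih =>
    have h := P.pairingIn_eq_add_of_root_eq_smul_add_smul (S := ℤ) (j := extRoot b θ i) (x := 1)
      (y := n) (i := (affAct b θ L β).1) (l := (affAct b θ L γ).1) (k := (affAct b θ L ε).1)
      (by rw [one_smul]; exact ih.1)
    simp only [affAct, affRefl, P.root_reflectionPerm, ih.1, map_add, map_zsmul, true_and]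
    rw [h, ih.2]
    simp only [smul_eq_mul]
    ring

/-- This is w s_i w⁻¹ = s_{wα_i} in the case where wα_i is simple. -/
theorem affAct_affRefl_of_eq (b : P.Base) (θ : ι) {L : List (Option b.support)}
    {i j : Option b.support} (h : affAct b θ L (affSimple b θ i) = affSimple b θ j) (β : ι × ℤ) :
    affAct b θ L (affRefl b θ i β) = affRefl b θ j (affAct b θ L β) := by
  have h1 := pairingIn_affAct b θ L β (affSimple b θ i)
  have h2 := root_affAct_add_zsmul b θ L (β := β) (γ := affSimple b θ i)
    (ε := affRefl b θ i β) (n := -P.pairingIn ℤ β.1 (extRoot b θ i))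
    (by
      rw [affRefl, root_reflectionPerm_eq, neg_smul, ← sub_eq_add_neg, Int.cast_smul_eq_zsmul]
      rfl)
    (by simp only [affRefl, affSimple]; ring)
  rw [h] at h1 h2
  simp only [affSimple] at h1 h2
  rw [← h1] at h2
  ext
  · apply P.root.injective
    rw [h2.1, affRefl, root_reflectionPerm_eq, neg_smul, ← sub_eq_add_neg, Int.cast_smul_eq_zsmul]
  · rw [h2.2, affRefl]; ring

variable [P.IsRootSystem] [P.IsReduced] [P.IsIrreducible] [Finite ι]

/-- Apply the letters of L to α_i from the right. The letter j that first makes the root negative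
meets it as α_j, so passing s_i to the left up to this letter turns it into s_j, and the two cancel.
-/
theorem exists_affAct_eq_of_not_affPos (b : P.Base) {θ : ι} (hθ : ∀ k, b.height k ≤ b.height θ)
    (L : List (Option b.support)) (i : Option b.support)
    (h : ¬ AffPos b (affAct b θ L (affSimple b θ i))) :
    ∃ L' : List (Option b.support), L'.length + 1 = L.length ∧
      ∀ β, affAct b θ L (affRefl b θ i β) = affAct b θ L' β := by
  induction L with
  | nil => exact absurd (affPos_simple b θ i) h
  | cons j L ih =>
    by_cases hL : AffPos b (affAct b θ L (affSimple b θ i))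
    · have h1 : affAct b θ L (affSimple b θ i) = affSimple b θ j := by
        by_contra hne
        exact h (hL.affRefl b hθ hne)
      refine ⟨L, rfl, fun β => ?_⟩
      rw [affAct, affAct_affRefl_of_eq b θ h1, affRefl_affRefl]
    · obtain ⟨L', h1, h2⟩ := ih hL
      exact ⟨j :: L', by simp [h1], fun β => by rw [affAct, h2, affAct]⟩

/-- An element of the affine Weyl group which preserves positivity is the identity. -/
theorem affAct_eq_self (b : P.Base) {θ : ι} (hθ : ∀ k, b.height k ≤ b.height θ)
    (L : List (Option b.support)) (h : ∀ i, AffPos b (affAct b θ L (affSimple b θ i)))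
    (β : ι × ℤ) : affAct b θ L β = β := by
  generalize hn : L.length = n
  induction n using Nat.strong_induction_on generalizing L with
  | _ n ih =>
  rcases L.eq_nil_or_concat' with rfl | ⟨L', i, rfl⟩
  · rfl
  · have h1 := h i
    have hcons : ∀ γ, affAct b θ (L' ++ [i]) γ = affAct b θ L' (affRefl b θ i γ) := fun γ => by
      rw [affAct_append]; rfl
    rw [hcons, affRefl_simple, affAct_neg, affPos_affNeg_iff] at h1
    obtain ⟨L'', h2, h3⟩ := exists_affAct_eq_of_not_affPos b hθ L' i h1
    have h4 : ∀ γ, affAct b θ (L' ++ [i]) γ = affAct b θ L'' γ := fun γ => by rw [hcons, h3]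
    rw [h4]
    refine ih L''.length (by simp at hn; omega) L'' (fun j => ?_) rfl
    rw [← h4]
    exact h j

theorem affAct_fst_congr (b : P.Base) (θ : ι) (L : List (Option b.support)) {β γ : ι × ℤ}
    (h : β.1 = γ.1) : (affAct b θ L β).1 = (affAct b θ L γ).1 := by
  induction L with
  | nil => exact h
  | cons i L ih => simp [affAct, affRefl, ih]

theorem affAct_map_some_snd (b : P.Base) (θ : ι) (L : List b.support) (β : ι × ℤ) :
    (affAct b θ (L.map some) β).2 = β.2 := by
  induction L with
  | nil => rfl
  | cons i L ih => simpa [affAct, affRefl, imagCoef] using ih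

theorem exists_affAct_eq_reflectionPerm (b : P.Base) (θ a : ι) :
    ∃ L : List b.support, ∀ β : ι × ℤ,
      (affAct b θ (L.map some) β).1 = P.reflectionPerm a β.1 := by
  refine b.induction_reflect a (p := fun a => ∃ L : List b.support, ∀ β : ι × ℤ,
      (affAct b θ (L.map some) β).1 = P.reflectionPerm a β.1) ?_ ?_ ?_
  · rintro i ⟨L, hL⟩
    refine ⟨L, fun β => ?_⟩
    rw [hL]
    apply P.root.injective
    rw [root_reflectionPerm_eq, root_reflectionPerm_eq, P.pairingIn_reflectionPerm_self_right,
      root_neg]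
    simp
  · intro i hi
    exact ⟨[⟨i, hi⟩], fun β => rfl⟩
  · rintro i j ⟨L, hL⟩ hj
    refine ⟨⟨j, hj⟩ :: (L ++ [⟨j, hj⟩]), fun β => ?_⟩
    simp only [List.map_cons, List.map_append, List.map_nil, affAct, affAct_append, affRefl, hL,
      extRoot]
    apply P.root.injective
    simp only [P.root_reflectionPerm, P.reflection_reflectionPerm]
    rfl

/-- The linear part of s_none is the reflection in θ, itself a product of finite simple reflections.
Lifting the linear part to finite reflections removes any change of the imaginary part. -/
theorem exists_affAct_map_some_fst (b : P.Base) (θ : ι) (L : List (Option b.support)) :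
    ∃ L₀ : List b.support, ∀ β : ι × ℤ,
      (affAct b θ (L₀.map some) β).1 = (affAct b θ L β).1 := by
  induction L with
  | nil => exact ⟨[], fun β => rfl⟩
  | cons i L ih =>
    obtain ⟨L₀, h₀⟩ := ih
    obtain ⟨L₁, h₁⟩ := exists_affAct_eq_reflectionPerm b θ (extRoot b θ i)
    refine ⟨L₁ ++ L₀, fun β => ?_⟩
    rw [List.map_append, affAct_append, h₁, h₀]
    rfl

theorem affSimple_injective (b : P.Base) (θ : ι) : Function.Injective (affSimple b θ) := by
  intro i j h
  rw [affSimple, affSimple, Prod.mk.injEq] at h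
  cases i with
  | none =>
    cases j with
    | none => rfl
    | some j => exact absurd h.2 (by simp [imagCoef])
  | some i =>
    cases j with
    | none => exact absurd h.2 (by simp [imagCoef])
    | some j => exact congrArg some (Subtype.ext h.1)

end Exchange

/-! ### The involution ι and the vertex where the game ends. -/

section SpecialAut

variable {ι M N : Type*} [AddCommGroup M] [Module ℝ M] [AddCommGroup N] [Module ℝ N]
  {P : RootPairing ι ℝ M N} [P.IsCrystallographic]
  [P.IsRootSystem] [P.IsReduced] [P.IsIrreducible] [Finite ι]

/-- If the linear part of an element of the affine Weyl group permutes the simple roots as `π`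
and `π²` fixes `none`, then `π² = 1`. -/
theorem apply_apply_eq_of_affAct_fst (b : P.Base) {θ : ι} (hθ : ∀ k, b.height k ≤ b.height θ)
    {L : List (Option b.support)} {π : Equiv.Perm (Option b.support)}
    (hL : ∀ i, (affAct b θ L (affSimple b θ i)).1 = extRoot b θ (π i))
    (hπ : π (π none) = none) (i : Option b.support) : π (π i) = i := by
  -- The finite Weyl element with the linear part of w² keeps imaginary parts. As π² fixes `none`,
  -- it permutes the affine simple roots by π², so it preserves positivity and is the identity.
  obtain ⟨L₀, h₀⟩ := exists_affAct_map_some_fst b θ (L ++ L)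
  have h1 : ∀ i, affAct b θ (L₀.map some) (affSimple b θ i) = affSimple b θ (π (π i)) := by
    intro i
    ext
    · rw [h₀, affAct_append, affAct_fst_congr b θ L (γ := affSimple b θ (π i)) (hL i), hL]
      rfl
    · rw [affAct_map_some_snd]
      cases i with
      | none => rw [hπ]
      | some j =>
        cases h : π (π (some j)) with
        | none =>
          rw [← hπ] at h
          exact absurd (π.injective (π.injective h)) (by simp)
        | some k => rfl
  apply affSimple_injective b θ
  rw [← h1]
  exact affAct_eq_self b hθ _ (fun j => by rw [h1]; exact affPos_simple b θ _) _

theorem omegaVec_eq_intCast {I : Type*} (i j : I) : ∃ n : ℤ, omegaVec i j = n := by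
  by_cases h : j = i
  · exact ⟨1, by simp [omegaVec, h]⟩
  · exact ⟨0, by simp [omegaVec, h]⟩

theorem HeightLike.eq_intCast {b : P.Base} {θ : ι} {v : Option b.support → ℝ}
    (hv : HeightLike b θ v) (i : Option b.support) : ∃ n : ℤ, v i = n := by
  obtain ⟨n, hn, -⟩ := hv.2 [] i
  exact ⟨n, hn⟩

/-- The automorphism by which the translation by `ρ` permutes the affine simple roots modulo the
affine Weyl group. -/
theorem exists_translation_aut (b : P.Base) {θ : ι} (hθ : ∀ k, b.height k ≤ b.height θ) :
    ∃ (L : List (Option b.support)) (π : Equiv.Perm (Option b.support)),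
      IsGraphAut (extCartan b θ) π ∧
      (∀ i, (affAct b θ L (affSimple b θ i)).1 = extRoot b θ (π i)) ∧
      ∀ j, extDelta b θ j = 1 → omegaVec (π.symm j) -
        (omegaVec j - rhoVec (extDelta b θ) none) ∈ rowLattice (extCartan b θ) := by
  have hρ := heightLike_rhoVec_none b hθ
  -- Starting from -ρ instead of ρ makes w carry ρ to +ρ^(p), so the roots wα_i have heights 1 and,
  -- at p, -l.
  obtain ⟨L, p, hp, h1, h2⟩ := hρ.neg.exists_play_eq_neg_rhoVec hθ
  rw [play_neg, neg_inj] at h1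
  have h3 : ∀ i, (b.height (affAct b θ L (affSimple b θ i)).1 : ℝ) =
      rhoVec (extDelta b θ) p i := fun i => by
    rw [← h1, play_apply, affEval_rhoVec_none]
  have h4 : ∀ i, ((affAct b θ L (affSimple b θ i)).2 : ℝ) =
      omegaVec p i + rhoVec (extDelta b θ) p i := fun i => by
    rw [← Pi.add_apply, ← h2, play_apply, affEval_omegaVec_none]
  -- Heights 1 and -l single out the simple roots and -θ. Each wα_i is thus an affine simple root
  -- moved by the translation (a, k) ↦ (a, k + ht(a)).
  have h5 : ∀ i, ∃ m, affAct b θ L (affSimple b θ i) =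
      (extRoot b θ m, imagCoef m + b.height (extRoot b θ m)) := by
    intro i
    have h6 := h3 i
    have h7 := h4 i
    generalize affAct b θ L (affSimple b θ i) = β at h6 h7
    rw [← h6] at h7
    obtain ⟨a, k⟩ := β
    by_cases hi : i = p
    · rw [hi, rhoVec_self b θ hp] at h6
      have h8 : b.height a = -b.height θ := by exact_mod_cast h6
      have h9 : P.reflectionPerm a a = θ :=
        eq_highest_of_height_eq b hθ (by rw [height_neg, h8, neg_neg])
      have h10 : a = P.reflectionPerm θ θ := by
        apply P.root.injective
        rw [root_neg, ← h9, root_neg, neg_neg]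
      refine ⟨none, ?_⟩
      have h11 : k = 1 + b.height a := by
        simp only [omegaVec, hi, if_true] at h7
        exact_mod_cast h7
      simp [extRoot, imagCoef, h11, h10]
    · rw [rhoVec_of_ne _ hi] at h6
      have h8 : b.height a = 1 := by exact_mod_cast h6
      refine ⟨some ⟨a, mem_support_of_height_eq_one b h8⟩, ?_⟩
      have h11 : k = b.height a := by
        simp only [omegaVec, hi, if_false, zero_add] at h7
        exact_mod_cast h7
      simp [extRoot, imagCoef, h11]
  choose π hπ using h5
  have hinj : Function.Injective π := by
    intro i j hij
    apply affSimple_injective b θ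
    apply affAct_injective b θ L
    rw [hπ, hπ, hij]
  let π' : Equiv.Perm (Option b.support) :=
    Equiv.ofBijective π (Finite.injective_iff_bijective.1 hinj)
  have hπ' : ∀ i, affAct b θ L (affSimple b θ i) =
      (extRoot b θ (π' i), imagCoef (π' i) + b.height (extRoot b θ (π' i))) := hπ
  refine ⟨L, π', fun i j => ?_, fun i => by rw [hπ'], fun j hj => ?_⟩
  · have := pairingIn_affAct b θ L (affSimple b θ j) (affSimple b θ i)
    rw [hπ', hπ'] at this
    exact this
  -- The same play takes ω^(j) - ρ to ω^(π⁻¹j): the height added by the translation cancels against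
  -- -ρ.
  · have h6 := play_sub_mem_rowLattice (extCartan b θ)
      (omegaVec j + (-1 : ℝ) • rhoVec (extDelta b θ) none) (fun i => by
        obtain ⟨n, hn⟩ := omegaVec_eq_intCast j i
        obtain ⟨m, hm⟩ := hρ.eq_intCast i
        exact ⟨n - m, by simp [hn, hm, sub_eq_add_neg]⟩) L
    have h7 : play (extCartan b θ) (omegaVec j + (-1 : ℝ) • rhoVec (extDelta b θ) none) L =
        omegaVec (π'.symm j) := by
      funext i
      have h8 : affEval b θ (omegaVec j) (extRoot b θ (π' i),
          imagCoef (π' i) + b.height (extRoot b θ (π' i))) =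
          omegaVec j (π' i) + b.height (extRoot b θ (π' i)) := by
        rw [← affEval_simple b θ (omegaVec j) (π' i)]
        simp only [affEval, affSimple, level_omegaVec, hj]
        push_cast
        ring
      rw [play_apply, hπ', affEval_add_smul, affEval_rhoVec_none, h8]
      rw [← omegaVec_comp]
      simp
    rw [h7, neg_one_smul, ← sub_eq_add_neg] at h6
    exact h6

/-- The involution acting on level-one basis vectors modulo the row lattice as the translation
by `ρ`. -/
theorem exists_involutive_aut (b : P.Base) {θ : ι} (hθ : ∀ k, b.height k ≤ b.height θ) :
    ∃ π : Equiv.Perm (Option b.support), IsGraphAut (extCartan b θ) π ∧ (∀ i, π (π i) = i) ∧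
      ∀ j, extDelta b θ j = 1 → omegaVec (π j) -
        (omegaVec j + rhoVec (extDelta b θ) none) ∈ rowLattice (extCartan b θ) := by
  obtain ⟨L, π, h1, h2, h3⟩ := exists_translation_aut b hθ
  -- As -ρ is height-like too, 2ρ lies in the row lattice, so π⁻¹ acts on classes both as -ρ and as
  -- +ρ; using each sign once shows that π⁻² fixes `none`.
  have h4 := (heightLike_rhoVec_none b hθ).neg.rhoVec_none_sub_mem hθ
  have h5 : ∀ j, extDelta b θ j = 1 → omegaVec (π.symm j) -
      (omegaVec j + rhoVec (extDelta b θ) none) ∈ rowLattice (extCartan b θ) := by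
    intro j hj
    have := sub_mem (h3 j hj) h4
    convert this using 1
    abel
  have h6 : π.symm (π.symm none) = none := by
    have hδ : ∀ j, extDelta b θ j = 1 → extDelta b θ (π.symm j) = 1 := fun j hj => by
      rw [h1.symm.extDelta_apply hθ, hj]
    have h0 := extDelta_none b θ
    refine eq_of_omegaVec_sub_mem b hθ (hδ _ (hδ _ h0)) h0 ?_
    have := add_mem (h3 _ (hδ _ h0)) (h5 _ h0)
    convert this using 1
    abel
  have h7 : ∀ i, π (π i) = i := apply_apply_eq_of_affAct_fst b hθ h2 (by
    rw [Equiv.symm_apply_eq, Equiv.symm_apply_eq] at h6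
    exact h6.symm)
  refine ⟨π, h1, h7, fun j hj => ?_⟩
  have h8 : π j = π.symm j := by rw [Equiv.eq_symm_apply, h7]
  rw [h8]
  exact h5 j hj

/-- The end of the game from `ρ + κω`. -/
theorem play_rhoVec_eq (b : P.Base) {θ : ι} (hθ : ∀ k, b.height k ≤ b.height θ)
    {π : Equiv.Perm (Option b.support)} (hπ : IsGraphAut (extCartan b θ) π)
    (hπ' : ∀ j, extDelta b θ j = 1 → omegaVec (π j) -
      (omegaVec j + rhoVec (extDelta b θ) none) ∈ rowLattice (extCartan b θ))
    {κ : ℝ} (hκ : 1 < κ) (hκ' : (κ - 1) * ((b.height θ : ℝ) - 1) < 1)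
    {L : List (Option b.support)}
    (hL : ∀ i, 0 ≤ play (extCartan b θ)
      (rhoVec (extDelta b θ) none + κ • omegaVec none) L i) :
    play (extCartan b θ) (rhoVec (extDelta b θ) none) L = -rhoVec (extDelta b θ) (π none) ∧
      play (extCartan b θ) (omegaVec none) L =
        omegaVec (π none) + rhoVec (extDelta b θ) (π none) := by
  have hρ := heightLike_rhoVec_none b hθ
  obtain ⟨p, hp, h1, h2⟩ := play_eq_of_nonneg_of_small b hθ hκ hκ' hρ hL
  have h3 := play_sub_mem_rowLattice (extCartan b θ) _ hρ.eq_intCast L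
  have h4 := play_sub_mem_rowLattice (extCartan b θ) _ (omegaVec_eq_intCast none) L
  rw [h1] at h3
  rw [h2] at h4
  have h0 := extDelta_none b θ
  -- Adding ω^(p) + ρ^(p) ≡ ω and -ρ^(p) ≡ ρ gives ω^(p) ≡ ω + ρ.
  have h5 : p = π none := by
    refine eq_of_omegaVec_sub_mem b hθ hp (by rw [hπ.extDelta_apply hθ, h0]) ?_
    have := sub_mem (add_mem h3 h4) (hπ' none h0)
    convert this using 1
    abel
  rw [← h5]
  exact ⟨h1, h2⟩

/-- All ρ^(τ none) are congruent to ρ^(none), so the congruence characterizing π is invariant under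
τ. This makes one ι serve every extending vertex. -/
theorem apply_comm_none (b : P.Base) {θ : ι} (hθ : ∀ k, b.height k ≤ b.height θ)
    {π : Equiv.Perm (Option b.support)} (hπ : IsGraphAut (extCartan b θ) π)
    (hπ' : ∀ j, extDelta b θ j = 1 → omegaVec (π j) -
      (omegaVec j + rhoVec (extDelta b θ) none) ∈ rowLattice (extCartan b θ))
    {τ : Equiv.Perm (Option b.support)} (hτ : IsGraphAut (extCartan b θ) τ) :
    τ (π none) = π (τ none) := by
  have h0 := extDelta_none b θ
  have hτ0 : extDelta b θ (τ none) = 1 := by rw [hτ.extDelta_apply hθ, h0]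
  refine eq_of_omegaVec_sub_mem b hθ
    (by rw [hτ.extDelta_apply hθ, hπ.extDelta_apply hθ, h0])
    (by rw [hπ.extDelta_apply hθ, hτ0]) ?_
  have h1 := hτ.comp_mem_rowLattice (hπ' none h0)
  have h2 : (omegaVec (π none) - (omegaVec none + rhoVec (extDelta b θ) none)) ∘ τ.symm =
      omegaVec (τ (π none)) - (omegaVec (τ none) + rhoVec (extDelta b θ) (τ none)) := by
    rw [← omegaVec_comp τ, ← omegaVec_comp τ, ← hτ.rhoVec_comp hθ h0]
    rfl
  rw [h2] at h1
  have h3 := (hτ.heightLike_comp hθ (heightLike_rhoVec_none b hθ)).rhoVec_none_sub_mem hθ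
  rw [hτ.rhoVec_comp hθ h0] at h3
  have := sub_mem (sub_mem h1 (hπ' _ hτ0)) h3
  convert this using 1
  abel

end SpecialAut

/-! ### Transfer to an arbitrary extending vertex. -/

section Conclusion

variable {ι M N : Type*} [AddCommGroup M] [Module ℝ M] [AddCommGroup N] [Module ℝ N]
  {P : RootPairing ι ℝ M N} [P.IsCrystallographic]
  [P.IsRootSystem] [P.IsReduced] [P.IsIrreducible] [Finite ι]

theorem IsMaximalFiringSeq.play_ge {I : Type*} {C : Matrix I I ℤ} {t : ℝ} {v : I → ℝ} {L : List I}
    (h : IsMaximalFiringSeq C t v L) (i : I) : t ≤ play C v L i := by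
  by_contra! hlt
  exact h.2 i ((isFiringSeq_append_singleton C t v L i).2 ⟨h.1, hlt⟩)

theorem isMaximalFiringSeq_congr {I : Type*} {C : Matrix I I ℤ} {s t : ℝ} {v w : I → ℝ}
    (h : ∀ L, IsFiringSeq C s v L ↔ IsFiringSeq C t w L) (L : List I) :
    IsMaximalFiringSeq C s v L ↔ IsMaximalFiringSeq C t w L := by
  simp only [IsMaximalFiringSeq, h]

theorem rhoVec_add_smul_comp {b : P.Base} {θ : ι} (hθ : ∀ k, b.height k ≤ b.height θ)
    {τ : Equiv.Perm (Option b.support)} (hτ : IsGraphAut (extCartan b θ) τ) (κ : ℝ) :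
    rhoVec (extDelta b θ) (τ none) + κ • omegaVec (τ none) =
      (rhoVec (extDelta b θ) none + κ • omegaVec none) ∘ τ.symm := by
  rw [← omegaVec_comp, ← hτ.rhoVec_comp hθ (extDelta_none b θ)]
  rfl

theorem isFiringSeq_iff_of_aut {b : P.Base} {θ : ι} (hθ : ∀ k, b.height k ≤ b.height θ)
    {τ : Equiv.Perm (Option b.support)} (hτ : IsGraphAut (extCartan b θ) τ)
    {κ : ℝ} (hκ : 1 < κ) (hκ' : (κ - 1) * ((b.height θ : ℝ) - 1) < 1)
    (L : List (Option b.support)) :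
    IsFiringSeq (extCartan b θ) 0
        (rhoVec (extDelta b θ) (τ none) + κ • omegaVec (τ none)) L ↔
      IsFiringSeq (extCartan b θ) (-1) (rhoVec (extDelta b θ) (τ none)) L := by
  rw [rhoVec_add_smul_comp hθ hτ, ← hτ.rhoVec_comp hθ (extDelta_none b θ), hτ.isFiringSeq_comp,
    hτ.isFiringSeq_comp]
  exact isFiringSeq_iff b hθ hκ hκ' _

theorem play_eq_of_isMaximalFiringSeq {b : P.Base} {θ : ι} (hθ : ∀ k, b.height k ≤ b.height θ)
    {π : Equiv.Perm (Option b.support)} (hπ : IsGraphAut (extCartan b θ) π)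
    (hπ' : ∀ j, extDelta b θ j = 1 → omegaVec (π j) -
      (omegaVec j + rhoVec (extDelta b θ) none) ∈ rowLattice (extCartan b θ))
    {τ : Equiv.Perm (Option b.support)} (hτ : IsGraphAut (extCartan b θ) τ)
    {κ : ℝ} (hκ : 1 < κ) (hκ' : (κ - 1) * ((b.height θ : ℝ) - 1) < 1)
    {L : List (Option b.support)}
    (hL : IsMaximalFiringSeq (extCartan b θ) 0
      (rhoVec (extDelta b θ) (τ none) + κ • omegaVec (τ none)) L) :
    play (extCartan b θ) (rhoVec (extDelta b θ) (τ none)) L =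
        -rhoVec (extDelta b θ) (π (τ none)) ∧
      play (extCartan b θ) (omegaVec (τ none)) L =
        omegaVec (π (τ none)) + rhoVec (extDelta b θ) (π (τ none)) := by
  have h0 := extDelta_none b θ
  have hπ0 : extDelta b θ (π none) = 1 := by rw [hπ.extDelta_apply hθ, h0]
  have hge := hL.play_ge
  rw [rhoVec_add_smul_comp hθ hτ, hτ.play_comp] at hge
  obtain ⟨h1, h2⟩ := play_rhoVec_eq b hθ hπ hπ' hκ hκ' (L := L.map τ.symm) fun i => by
    simpa using hge (τ i)
  rw [← apply_comm_none b hθ hπ hπ' hτ, ← omegaVec_comp τ none, ← omegaVec_comp τ (π none),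
    ← hτ.rhoVec_comp hθ h0, ← hτ.rhoVec_comp hθ hπ0, hτ.play_comp, hτ.play_comp, h1, h2]
  exact ⟨rfl, rfl⟩

theorem exists_not_isFiringSeq {b : P.Base} {θ : ι} (hθ : ∀ k, b.height k ≤ b.height θ)
    {u : Option b.support → ℝ} (hu : 0 < level b θ u) (s : ℕ → Option b.support) :
    ∃ n : ℕ, ¬ IsFiringSeq (extCartan b θ) 0 u ((List.range n).map s) := by
  refine ⟨(negSet b θ u).ncard + 1, fun h => ?_⟩
  have := h.length_le b hθ hu
  simp at this

end Conclusion

theorem proposition4p1 {ι M N : Type*} [Finite ι]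
    [AddCommGroup M] [Module ℝ M] [AddCommGroup N] [Module ℝ N]
    (P : RootPairing ι ℝ M N) [P.IsRootSystem] [P.IsCrystallographic] [P.IsReduced]
    [P.IsIrreducible] (b : P.Base)
    -- `θ` is the index of the longest root; its length is `b.height θ`
    (θ : ι) (hθ : ∀ k, b.height k ≤ b.height θ) :
    ∃ inv : Equiv.Perm (Option b.support),
      IsGraphAut (extCartan b θ) inv ∧ (∀ i, inv (inv i) = i) ∧
      ∀ i₀, IsExtendingVertex (extCartan b θ) i₀ →
      -- `κ ∈ (1, 1 + 1 / (l - 1))`, with `1 / 0 = ∞` if the longest root has length `l = 1`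
      ∀ κ : ℝ, 1 < κ → (κ - 1) * ((b.height θ : ℝ) - 1) < 1 →
        (∀ L : List (Option b.support),
          IsFiringSeq (extCartan b θ) 0 (rhoVec (extDelta b θ) i₀ + κ • omegaVec i₀) L ↔
            IsFiringSeq (extCartan b θ) (-1) (rhoVec (extDelta b θ) i₀) L) ∧
        -- there is no infinite firing sequence, so every one is part of a maximal finite one
        (∀ s : ℕ → Option b.support, ∃ n : ℕ,
          ¬ IsFiringSeq (extCartan b θ) 0 (rhoVec (extDelta b θ) i₀ + κ • omegaVec i₀)
            ((List.range n).map s)) ∧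
        (∀ L : List (Option b.support),
          IsMaximalFiringSeq (extCartan b θ) 0
              (rhoVec (extDelta b θ) i₀ + κ • omegaVec i₀) L →
            play (extCartan b θ) (rhoVec (extDelta b θ) i₀ + κ • omegaVec i₀) L =
              (κ - 1) • rhoVec (extDelta b θ) (inv i₀) + κ • omegaVec (inv i₀)) ∧
        (∀ L : List (Option b.support),
          IsMaximalFiringSeq (extCartan b θ) (-1) (rhoVec (extDelta b θ) i₀) L →
            play (extCartan b θ) (rhoVec (extDelta b θ) i₀) L =
              -rhoVec (extDelta b θ) (inv i₀)) := by
  obtain ⟨π, h1, h2, h3⟩ := exists_involutive_aut b hθ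
  refine ⟨π, h1, h2, ?_⟩
  rintro _ ⟨τ, hτ, rfl⟩ κ hκ hκ'
  have hiff := isFiringSeq_iff_of_aut hθ hτ hκ hκ'
  have hend := fun L => play_eq_of_isMaximalFiringSeq hθ h1 h3 hτ hκ hκ' (L := L)
  refine ⟨hiff, exists_not_isFiringSeq hθ ?_, fun L hL => ?_, fun L hL => ?_⟩
  · have hτ0 : extDelta b θ (τ none) = 1 := by rw [hτ.extDelta_apply hθ, extDelta_none]
    rw [level_add_smul, level_rhoVec b θ hτ0, level_omegaVec, hτ0]
    linarith
  · obtain ⟨h4, h5⟩ := hend L hL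
    rw [play_add_smul, h4, h5, smul_add, sub_smul, one_smul]
    abel
  · exact (hend L ((isMaximalFiringSeq_congr hiff L).2 hL)).1
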